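/- Setting. Consider a finite extensive-form game with perfect recall. The set $H$ of histories is a finite set of finite sequences of actions that contains $\langle\rangle$ and is closed under prefixes. A history is terminal if it is a proper prefix of no history, and $Z$ is the set of terminal histories. The set $\mathcal I$ of information sets partitions the non-terminal histories into non-empty sets; the acting player $N(I)$ and the set $A(I)$ of available actions are the same at all histories of $I$. Every player $i$ has a utility function $u_i : Z \to \mathbb{R}$. Perfect recall means that, at any two histories of an information set of player $i$, the sequences of information sets encountered and actions played by $i$ are identical. Actions available at different information sets are regarded as different. An assessment $(\beta,\mu)$ consists of a probability distribution $\beta(I)$ on $A(I)$ and a probability distribution $\mu(I)$ on $I$ for every $I\in\mathcal I$. We write $\beta(a)=\beta(I)(a)$ for $a\in A(I)$ and $\mu(h)=\mu(I)(h)$ for $h\in I$. If $h$ is a prefix of $h'$, then $P_\beta(h'\mid h)$ is the product of the probabilities of the actions that lead from $h$ to $h'$; otherwise $P_\beta(h'\mid h)=0$. Put $P_\beta(h)=P_\beta(h\mid\langle\rangle)$, $P_\beta(I)=\sum_{h\in I}P_\beta(h)$, $U^E_i(\beta\mid h)=\sum_{z\in Z}u_i(z)P_\beta(z\mid h)$ and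 $U^B_i(\beta,\mu\mid I)=\sum_{z\in Z}u_i(z)\sum_{h\in I}\mu(I)(h)P_\beta(z\mid h)$. The assessment is consistent if it is the limit of a sequence of assessments $(\beta^n,\mu^n)$ with $P_{\beta^n}(h)>0$ for all $h\in H$ and $\mu^n(I)(h)=P_{\beta^n}(h)/P_{\beta^n}(I)$ for all $I\in\mathcal I$, $h\in I$. It is sequentially rational if $U^B_i(\beta',\mu\mid I)\le U^B_i(\beta,\mu\mid I)$ for every $I\in\mathcal I$, where $i=N(I)$, and every strategy profile $\beta'$ that differs from $\beta$ only at information sets of player $i$. It is a sequential equilibrium if it is consistent and sequentially rational. The matrix. Let $a_1,\dots,a_{N_a}$ be all actions of the game, and let $(h^1_i,h^2_i)$, $1\le i\le N_p$, be a list of pairs of histories such that $h^1_i$ and $h^2_i$ always lie in a common information set and any two distinct histories of an information set occur as a pair, in at least one of the two orders. Let $M=N_p+N_a$. Let $A$ be the $M\times N_a$ matrix consisting of $\tilde A$ on top of the identity matrix, where $\tilde A_{i,j}$ is $1$ if $a_j$ is played in $h^1_i$ but not in $h^2_i$, is $-1$ if $a_j$ is played in $h^2_i$ but not in $h^1_i$,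 and is $0$ otherwise. For an assessment $(\beta,\mu)$ put $\alpha_i=\mu(h^1_i)$, $\gamma_i=\mu(h^2_i)$ for $1\le i\le N_p$ and $\alpha_{N_p+j}=\beta(a_j)$, $\gamma_{N_p+j}=1$ for $1\le j\le N_a$. The cones. For $b\in\{-\infty,0,\infty\}^M$ let $$C^A_b=\{p\in\mathbb{R}^M : pA=0,\ p_i\ge0 \text{ if } b_i=\infty,\ p_i\le0\text{ if }b_i=-\infty\}.$$ A set of extreme directions (conical basis) of a cone $C$ is a finite set of vectors with integer entries such that $C$ is the set of all their linear combinations with non-negative real coefficients. Theorem (Consistency as Polynomial Equations). Each cone $C^A_b$ has such a set of extreme directions. Choose one, $ED(C)$, for each cone $C=C^A_b$, and let $\mathcal E^A$ be the union of the $ED(C^A_b)$ over all $b\in\{-\infty,0,\infty\}^M$. Then, whatever the choice, $\mathcal E^A$ is finite, and for every assessment $(\beta,\mu)$: (1) $(\beta,\mu)$ is consistent if and only if for all $p\in\mathcal E^A$ $$\prod_{p_i>0}\alpha_i^{p_i}\prod_{p_i<0}\gamma_i^{-p_i}=\prod_{p_i>0}\gamma_i^{p_i}\prod_{p_i<0}\alpha_i^{-p_i};$$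 (2) $(\beta,\mu)$ is a sequential equilibrium if and only if the equations in (1) hold for all $p\in\mathcal E^A$ and, for all $I\in\mathcal I$ and $a\in A(I)$, with $i=N(I)$ and $D=\sum_{h\in I}\mu(I)(h)\,U^E_i(\beta\mid\langle h,a\rangle)-U^B_i(\beta,\mu\mid I)$, we have $D\le0$ and $\beta(I)(a)\cdot D=0$. -/

import Mathlib

/-- A finite extensive-form game with players `N` and actions `Act`. Histories are finite sequences
of actions. The information sets partition the non-terminal histories. The acting player is
attached to the information set, so that it is the same at all histories of an information set. -/
structure ExtensiveGame (N Act : Type*) [Fintype Act] [DecidableEq Act] where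
  /-- the finite set of histories -/
  histories : Finset (List Act)
  nil_mem : [] ∈ histories
  prefix_mem : ∀ h h' : List Act, h' ∈ histories → h <+: h' → h ∈ histories
  /-- the information sets: a partition of the non-terminal histories into non-empty sets -/
  infoSets : Finpartition (histories.filter fun h => ∃ a, h ++ [a] ∈ histories)
  /-- the same actions are available at all histories of an information set -/
  actions_eq : ∀ I ∈ infoSets.parts, ∀ h ∈ I, ∀ h' ∈ I, ∀ a,
    (h ++ [a] ∈ histories ↔ h' ++ [a] ∈ histories)
  /-- the player acting at an information set -/
  player : Finset (List Act) → N
  /-- the utility of a player at a terminal history -/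
  utility : N → List Act → ℝ

namespace ExtensiveGame

variable {N Act : Type*} [Fintype Act] [DecidableEq Act]

/-- The terminal histories: those that are a proper prefix of no history. -/
def terminals (G : ExtensiveGame N Act) : Finset (List Act) :=
  G.histories.filter fun h => ¬ ∃ a, h ++ [a] ∈ G.histories

/-- The actions available at an information set. -/
def actions (G : ExtensiveGame N Act) (I : Finset (List Act)) : Finset Act :=
  Finset.univ.filter fun a => ∃ h ∈ I, h ++ [a] ∈ G.histories

/-- All actions of the game. An action is identified by its information set and its label, so that
each of these actions can be played in exactly one information set. -/
def allActions (G : ExtensiveGame N Act) : Finset (Finset (List Act) × Act) :=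
  (G.infoSets.parts ×ˢ Finset.univ).filter fun m => m.2 ∈ G.actions m.1

/-- The actions played along the history `⟨a₁, …, aₖ⟩`, in order: the list of the
`(Iₗ, aₗ)`, where `Iₗ` is the information set containing `⟨a₁, …, aₗ₋₁⟩`. -/
def moves (G : ExtensiveGame N Act) (h : List Act) : List (Finset (List Act) × Act) :=
  (h.inits.zip h).map fun s => (G.infoSets.part s.1, s.2)

/-- Perfect recall: at any two histories of an information set of player `i`, the sequences of the
information sets encountered and actions played by `i` so far are identical. -/
def PerfectRecall [DecidableEq N] (G : ExtensiveGame N Act) : Prop :=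
  ∀ I ∈ G.infoSets.parts, ∀ h ∈ I, ∀ h' ∈ I,
    (G.moves h).filter (fun m => G.player m.1 = G.player I) =
      (G.moves h').filter (fun m => G.player m.1 = G.player I)

/-- `β I a` is the probability of action `a` at information set `I`. Only the values at information
sets `I` and available actions `a ∈ A(I)` matter. -/
def IsStrategy (G : ExtensiveGame N Act) (β : Finset (List Act) → Act → ℝ) : Prop :=
  ∀ I ∈ G.infoSets.parts, (∀ a ∈ G.actions I, 0 ≤ β I a) ∧ ∑ a ∈ G.actions I, β I a = 1

/-- `μ I h` is the belief at information set `I` to be in the history `h ∈ I`. Only these values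
matter. -/
def IsBeliefSystem (G : ExtensiveGame N Act) (μ : Finset (List Act) → List Act → ℝ) : Prop :=
  ∀ I ∈ G.infoSets.parts, (∀ h ∈ I, 0 ≤ μ I h) ∧ ∑ h ∈ I, μ I h = 1

/-- An assessment: a behavioral strategy profile and a system of beliefs. -/
def IsAssessment (G : ExtensiveGame N Act) (β : Finset (List Act) → Act → ℝ)
    (μ : Finset (List Act) → List Act → ℝ) : Prop :=
  G.IsStrategy β ∧ G.IsBeliefSystem μ

/-- The probability `P_β(h)` of reaching the history `h`. -/
def prob (G : ExtensiveGame N Act) (β : Finset (List Act) → Act → ℝ) (h : List Act) : ℝ :=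
  ((G.moves h).map fun m => β m.1 m.2).prod

/-- The conditional probability `P_β(h' | h)` of reaching `h'` from `h`: the product of the action
probabilities on the way from `h` to `h'` if `h` is a prefix of `h'`, and `0` otherwise. -/
def condProb (G : ExtensiveGame N Act) (β : Finset (List Act) → Act → ℝ) (h' h : List Act) : ℝ :=
  if h <+: h' then (((G.moves h').drop h.length).map fun m => β m.1 m.2).prod else 0

/-- The expected utility `U^E_i(β | h)` of player `i` in the subgame starting at `h`. -/
def expectedUtility (G : ExtensiveGame N Act) (i : N) (β : Finset (List Act) → Act → ℝ)
    (h : List Act) : ℝ :=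
  ∑ z ∈ G.terminals, G.utility i z * G.condProb β z h

/-- The believed utility `U^B_i(β, μ | I)` of player `i` at the information set `I`. -/
def believedUtility (G : ExtensiveGame N Act) (i : N) (β : Finset (List Act) → Act → ℝ)
    (μ : Finset (List Act) → List Act → ℝ) (I : Finset (List Act)) : ℝ :=
  ∑ z ∈ G.terminals, G.utility i z * ∑ h ∈ I, μ I h * G.condProb β z h

/-- Consistency: the assessment is a limit of assessments under which every history has positive
probability and whose beliefs are given by Bayes' rule. -/
def Consistent (G : ExtensiveGame N Act) (β : Finset (List Act) → Act → ℝ)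
    (μ : Finset (List Act) → List Act → ℝ) : Prop :=
  ∃ (βs : ℕ → Finset (List Act) → Act → ℝ) (μs : ℕ → Finset (List Act) → List Act → ℝ),
    (∀ n, G.IsAssessment (βs n) (μs n)) ∧
    (∀ n, ∀ h ∈ G.histories, 0 < G.prob (βs n) h) ∧
    (∀ n, ∀ I ∈ G.infoSets.parts, ∀ h ∈ I,
      μs n I h = G.prob (βs n) h / ∑ h' ∈ I, G.prob (βs n) h') ∧
    (∀ I ∈ G.infoSets.parts, ∀ a ∈ G.actions I,
      Filter.Tendsto (fun n => βs n I a) Filter.atTop (nhds (β I a))) ∧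
    (∀ I ∈ G.infoSets.parts, ∀ h ∈ I,
      Filter.Tendsto (fun n => μs n I h) Filter.atTop (nhds (μ I h)))

/-- Sequential rationality: at no information set can the acting player improve the believed
utility by changing their own strategy. -/
def SequentiallyRational (G : ExtensiveGame N Act) (β : Finset (List Act) → Act → ℝ)
    (μ : Finset (List Act) → List Act → ℝ) : Prop :=
  ∀ I ∈ G.infoSets.parts, ∀ β' : Finset (List Act) → Act → ℝ, G.IsStrategy β' →
    (∀ J ∈ G.infoSets.parts, G.player J ≠ G.player I → ∀ a ∈ G.actions J, β' J a = β J a) →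
    G.believedUtility (G.player I) β' μ I ≤ G.believedUtility (G.player I) β μ I

/-- An assessment is a sequential equilibrium if it is sequentially rational and consistent. -/
def SequentialEquilibrium (G : ExtensiveGame N Act) (β : Finset (List Act) → Act → ℝ)
    (μ : Finset (List Act) → List Act → ℝ) : Prop :=
  G.SequentiallyRational β μ ∧ G.Consistent β μ

/-- `pairs` lists the pairs of histories that lie in a common information set: it has only such
pairs, and any two distinct histories of an information set occur in it, in at least one of the
two orders. (So `pairs` may be the set of all ordered pairs, with or without the pairs `(h, h)`,
or contain each unordered pair once.) -/
def ListsPairs (G : ExtensiveGame N Act) (pairs : Finset (List Act × List Act)) : Prop :=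
  (∀ q ∈ pairs, ∃ I ∈ G.infoSets.parts, q.1 ∈ I ∧ q.2 ∈ I) ∧
  (∀ I ∈ G.infoSets.parts, ∀ h ∈ I, ∀ h' ∈ I, h ≠ h' → (h, h') ∈ pairs ∨ (h', h) ∈ pairs)

/-- The coefficient matrix `A` of the linear system: the matrix `Ã`, whose rows are the pairs of
histories, above the identity matrix; the columns are the actions of the game. -/
def systemMatrix (G : ExtensiveGame N Act) (pairs : Finset (List Act × List Act)) :
    Matrix (↥pairs ⊕ ↥G.allActions) ↥G.allActions ℝ :=
  Matrix.fromRows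
    (Matrix.of fun q j =>
      if j.1 ∈ G.moves q.1.1 ∧ j.1 ∉ G.moves q.1.2 then 1
      else if j.1 ∉ G.moves q.1.1 ∧ j.1 ∈ G.moves q.1.2 then -1
      else 0)
    1

/-- `α`: the belief in the first history of a pair, and the probability of an action. -/
def alpha (G : ExtensiveGame N Act) (pairs : Finset (List Act × List Act))
    (β : Finset (List Act) → Act → ℝ) (μ : Finset (List Act) → List Act → ℝ) :
    ↥pairs ⊕ ↥G.allActions → ℝ :=
  Sum.elim (fun q => μ (G.infoSets.part q.1.1) q.1.1) (fun j => β j.1.1 j.1.2)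

/-- `γ`: the belief in the second history of a pair, and `1` for an action. -/
def gamma (G : ExtensiveGame N Act) (pairs : Finset (List Act × List Act))
    (μ : Finset (List Act) → List Act → ℝ) : ↥pairs ⊕ ↥G.allActions → ℝ :=
  Sum.elim (fun q => μ (G.infoSets.part q.1.2) q.1.2) (fun _ => 1)

end ExtensiveGame

/-- The cone `C^A_b` of all `p` with `pA = 0`, `p_i ≥ 0` if `b_i = ∞`, `p_i ≤ 0` if `b_i = -∞`. -/
def signCone {m n : Type*} [Fintype m] (A : Matrix m n ℝ) (b : m → EReal) : Set (m → ℝ) :=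
  {p | Matrix.vecMul p A = 0 ∧ ∀ i, (b i = ⊤ → 0 ≤ p i) ∧ (b i = ⊥ → p i ≤ 0)}

/-- The collection of all cones `C^A_b` with `b_i ∈ {-∞, 0, ∞}` for all `i`. -/
def signCones {m n : Type*} [Fintype m] (A : Matrix m n ℝ) : Set (Set (m → ℝ)) :=
  {C | ∃ b : m → EReal, (∀ i, b i = ⊥ ∨ b i = 0 ∨ b i = ⊤) ∧ C = signCone A b}

/-- The finite set `E` of integer vectors is a set of extreme directions (a conical basis) of `C`:
`C` is the set of all conical combinations of the vectors in `E`. -/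
def IsIntegerConicalBasis {m : Type*} (C : Set (m → ℝ)) (E : Finset (m → ℤ)) : Prop :=
  C = {x | ∃ c : (m → ℤ) → ℝ, (∀ e ∈ E, 0 ≤ c e) ∧ ∀ i, x i = ∑ e ∈ E, c e * (e i : ℝ)}

/-- `ED` chooses extreme directions with integer entries for each of the cones `C^A_b`. -/
def IsExtremeDirectionChoice {m n : Type*} [Fintype m] (A : Matrix m n ℝ)
    (ED : Set (m → ℝ) → Finset (m → ℤ)) : Prop :=
  ∀ C ∈ signCones A, IsIntegerConicalBasis C (ED C)

/-- The set `E^A`: the union of the sets of extreme directions of all the cones `C^A_b`. -/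
def allExtremeDirections {m n : Type*} [Fintype m] (A : Matrix m n ℝ)
    (ED : Set (m → ℝ) → Finset (m → ℤ)) : Set (m → ℤ) :=
  ⋃ C ∈ signCones A, (ED C : Set (m → ℤ))

/-- The polynomial equation with exponent vector `p`. -/
def PolynomialEquation {m : Type*} [Fintype m] (α γ : m → ℝ) (p : m → ℤ) : Prop :=
  (∏ i with 0 < p i, α i ^ (p i).toNat) * (∏ i with p i < 0, γ i ^ (-p i).toNat) =
    (∏ i with 0 < p i, γ i ^ (p i).toNat) * (∏ i with p i < 0, α i ^ (-p i).toNat)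

/-! Under a completely mixed assessment with Bayesian beliefs, the vector of all `log α_i - log γ_i`
equals `A x` with `x_j = log β(a_j)`: actions common to both histories of a pair cancel, and so does
the probability of the information set. Any `p` with `pA = 0` is therefore orthogonal to it. For
integer `p`, exponentiating gives the polynomial equation, which survives limits
(`PerfectRecall.polynomialEquation_of_consistent`).

Conversely, one needs vectors `A x` whose entries approach `log (α_i / γ_i)`, where a zero on one
side means `±∞` and zeros on both sides mean no constraint. The admissible vectors form an open
convex box. If the range of `A` missed a box, Hahn–Banach would give `p` with `pA = 0`, positive on
the box. Unbounded coordinates force `p_i ≥ 0` where `γ_i = 0` and `p_i ≤ 0` where `α_i = 0`. Inside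
its orthant cone, `p` decomposes into extreme directions of compatible signs, one of which, `e`, is
still positive at a chosen point of the box. One side of the equation of `e` is then a product of
positive numbers, hence so is the other; all `α_i`, `γ_i` on the support of `e` are positive, and
logarithms give the value zero, a contradiction (`exists_mulVec_mem_logWindow`). The exponentials of
`x`, normalised at each information set, are the required mixed strategies
(`consistent_of_tendsto_exp`).

Given consistency, sequential rationality reduces to single actions by the one-shot deviation
principle (`PerfectRecall.believedUtility_le`). It holds because beliefs at a later information set
of a player are proportional to those induced from an earlier one, whatever that player does in
between (`PerfectRecall.exists_belief_factor`). -/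

section Cones

/-! ### Integer generators of polyhedral cones -/

variable {m n : Type*}

/-- The cone of all non-negative combinations of the integer vectors in `E`. -/
def integerConicalHull (E : Finset (m → ℤ)) : Set (m → ℝ) :=
  {x | ∃ c : (m → ℤ) → ℝ, (∀ e ∈ E, 0 ≤ c e) ∧ ∀ i, x i = ∑ e ∈ E, c e * (e i : ℝ)}

theorem integerConicalHull_add {E : Finset (m → ℤ)} {x y : m → ℝ}
    (hx : x ∈ integerConicalHull E) (hy : y ∈ integerConicalHull E) :
    x + y ∈ integerConicalHull E := by
  obtain ⟨c, hc, hx⟩ := hx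
  obtain ⟨d, hd, hy⟩ := hy
  exact ⟨c + d, fun e he => add_nonneg (hc e he) (hd e he), fun i => by
    simp [hx, hy, add_mul, Finset.sum_add_distrib]⟩

theorem integerConicalHull_smul {E : Finset (m → ℤ)} {x : m → ℝ} {r : ℝ} (hr : 0 ≤ r)
    (hx : x ∈ integerConicalHull E) : r • x ∈ integerConicalHull E := by
  obtain ⟨c, hc, hx⟩ := hx
  exact ⟨r • c, fun e he => mul_nonneg hr (hc e he), fun i => by
    simp [hx, Finset.mul_sum, mul_assoc]⟩

theorem integerConicalHull_zero (E : Finset (m → ℤ)) : (0 : m → ℝ) ∈ integerConicalHull E :=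
  ⟨0, by simp, by simp⟩

theorem integerConicalHull_sum {ι : Type*} {E : Finset (m → ℤ)} (s : Finset ι) (f : ι → m → ℝ)
    (hf : ∀ i ∈ s, f i ∈ integerConicalHull E) : ∑ i ∈ s, f i ∈ integerConicalHull E := by
  classical
  induction s using Finset.induction_on with
  | empty => simpa using integerConicalHull_zero E
  | insert a s ha ih =>
    rw [Finset.sum_insert ha]
    exact integerConicalHull_add (hf a (Finset.mem_insert_self a s))
      (ih fun i hi => hf i (Finset.mem_insert_of_mem hi))

theorem mem_integerConicalHull {E : Finset (m → ℤ)} {e : m → ℤ} (he : e ∈ E) :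
    (fun i => (e i : ℝ)) ∈ integerConicalHull E := by
  classical
  refine ⟨fun e' => if e' = e then 1 else 0, fun e' _ => by positivity, fun i => ?_⟩
  simp [ite_mul, he]

theorem integerConicalHull_subset [Fintype m] {E F : Finset (m → ℤ)}
    (h : ∀ e ∈ E, (fun i => (e i : ℝ)) ∈ integerConicalHull F) :
    integerConicalHull E ⊆ integerConicalHull F := by
  rintro x ⟨c, hc, hx⟩
  have : x = ∑ e ∈ E, c e • fun i => (e i : ℝ) := by
    ext i
    simp [hx, Finset.sum_apply]
  rw [this]
  exact integerConicalHull_sum _ _ fun e he => integerConicalHull_smul (hc e he) (h e he)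

theorem integerConicalHull_univ [Fintype m] :
    ∃ E : Finset (m → ℤ), integerConicalHull E = Set.univ := by
  classical
  refine ⟨Finset.univ.image (fun i => Pi.single i 1) ∪ Finset.univ.image (fun i => Pi.single i (-1)),
    Set.eq_univ_of_forall fun x => ?_⟩
  have hx : x = ∑ i, Pi.single i (x i) := (Finset.univ_sum_single x).symm
  rw [hx]
  refine integerConicalHull_sum _ _ fun i _ => ?_
  rcases le_total 0 (x i) with h | h
  · convert integerConicalHull_smul h (mem_integerConicalHull (e := Pi.single i 1) ?_) using 1
    · ext j
      by_cases hj : j = i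
      · subst hj; simp
      · simp [hj]
    · simp
  · convert integerConicalHull_smul (neg_nonneg.2 h)
      (mem_integerConicalHull (e := Pi.single i (-1)) ?_) using 1
    · ext j
      by_cases hj : j = i
      · subst hj; simp
      · simp [hj]
    · simp

/-- Cutting a cone with integer generators by a half-space with integer normal vector gives a cone
with integer generators. -/
theorem integerConicalHull_inter_halfspace [Fintype m] (E : Finset (m → ℤ)) (v : m → ℤ) :
    ∃ F : Finset (m → ℤ), integerConicalHull F =
      integerConicalHull E ∩ {x | 0 ≤ ∑ i, x i * (v i : ℝ)} := by
  classical
  let P := E.filter fun e => 0 ≤ ∑ i, e i * v i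
  let Q := E.filter fun e => ¬ 0 ≤ ∑ i, e i * v i
  -- For a generator inside the half-space and one outside, this is their combination with
  -- non-negative integer coefficients lying on the bounding hyperplane.
  let g : (m → ℤ) × (m → ℤ) → m → ℤ := fun q =>
    (∑ i, q.1 i * v i) • q.2 - (∑ i, q.2 i * v i) • q.1
  let F := P ∪ (P ×ˢ Q).image g
  have hval : ∀ e : m → ℤ, ((∑ i, e i * v i : ℤ) : ℝ) = ∑ i, (e i : ℝ) * (v i : ℝ) := by
    intro e; push_cast; rfl
  refine ⟨F, Set.Subset.antisymm (fun x hx => ⟨?_, ?_⟩) ?_⟩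
  · refine integerConicalHull_subset (fun e he => ?_) hx
    rcases Finset.mem_union.1 he with he | he
    · exact mem_integerConicalHull (Finset.mem_filter.1 he).1
    · obtain ⟨⟨p, q⟩, hpq, rfl⟩ := Finset.mem_image.1 he
      obtain ⟨hp, hq⟩ := Finset.mem_product.1 hpq
      obtain ⟨hp, hpv⟩ := Finset.mem_filter.1 hp
      obtain ⟨hq, hqv⟩ := Finset.mem_filter.1 hq
      have h1 : (0 : ℝ) ≤ ((∑ i, p i * v i : ℤ) : ℝ) := by exact_mod_cast hpv
      have h2 : (0 : ℝ) ≤ ((-∑ i, q i * v i : ℤ) : ℝ) := by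
        have : 0 ≤ -∑ i, q i * v i := by linarith
        exact_mod_cast this
      convert integerConicalHull_add (integerConicalHull_smul h1 (mem_integerConicalHull hq))
        (integerConicalHull_smul h2 (mem_integerConicalHull hp)) using 1
      ext i
      simp [g]
      ring
  · obtain ⟨c, hc, hx⟩ := hx
    have : ∑ i, x i * (v i : ℝ) = ∑ e ∈ F, c e * ((∑ i, e i * v i : ℤ) : ℝ) := by
      simp_rw [hx, Finset.sum_mul, hval, Finset.mul_sum]
      rw [Finset.sum_comm]
      simp_rw [mul_assoc]
    simp only [Set.mem_ofPred_eq, this]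
    refine Finset.sum_nonneg fun e he => mul_nonneg (hc e he) ?_
    rcases Finset.mem_union.1 he with he | he
    · exact_mod_cast (Finset.mem_filter.1 he).2
    · obtain ⟨⟨p, q⟩, -, rfl⟩ := Finset.mem_image.1 he
      have : ∑ i, g (p, q) i * v i = 0 := by
        simp only [g, Pi.sub_apply, Pi.smul_apply, smul_eq_mul, sub_mul, Finset.sum_sub_distrib,
          mul_assoc, ← Finset.mul_sum]
        ring
      rw [this]
      simp
  · rintro x ⟨⟨c, hc, hx⟩, hxv⟩
    let w : (m → ℤ) → ℝ := fun e => ((∑ i, e i * v i : ℤ) : ℝ)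
    have hwP : ∀ e ∈ P, 0 ≤ w e := fun e he => by
      exact Int.cast_nonneg (Finset.mem_filter.1 he).2
    have hwQ : ∀ e ∈ Q, w e < 0 := fun e he => by
      exact Int.cast_lt_zero.2 (not_le.1 (Finset.mem_filter.1 he).2)
    have hcP : ∀ e ∈ P, 0 ≤ c e := fun e he => hc e (Finset.mem_filter.1 he).1
    have hcQ : ∀ e ∈ Q, 0 ≤ c e := fun e he => hc e (Finset.mem_filter.1 he).1
    have hsplit : ∀ f : (m → ℤ) → ℝ, ∑ e ∈ E, f e = ∑ e ∈ P, f e + ∑ e ∈ Q, f e := fun f =>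
      (Finset.sum_filter_add_sum_filter_not E _ f).symm
    have hsum : 0 ≤ ∑ e ∈ P, c e * w e + ∑ e ∈ Q, c e * w e := by
      rw [← hsplit]
      convert hxv.out using 1
      simp_rw [hx, Finset.sum_mul, w, hval, Finset.mul_sum]
      rw [Finset.sum_comm]
      simp_rw [mul_assoc]
    set a := ∑ e ∈ P, c e * w e with ha
    set b := ∑ e ∈ Q, c e * w e with hb
    have hPF : ∀ e ∈ P, (fun i => (e i : ℝ)) ∈ integerConicalHull F := fun e he =>
      mem_integerConicalHull (Finset.mem_union_left _ he)
    have hb0 : b ≤ 0 := Finset.sum_nonpos fun e he =>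
      mul_nonpos_of_nonneg_of_nonpos (hcQ e he) (hwQ e he).le
    -- If `b = 0`, no outer generator is used. Otherwise `a ≥ -b > 0`, so division by `a` is
    -- allowed.
    rcases hb0.eq_or_lt with hb0 | hb0
    · have hz : ∀ e ∈ Q, c e = 0 := by
        intro e he
        have := (Finset.sum_eq_zero_iff_of_nonpos fun e he =>
          mul_nonpos_of_nonneg_of_nonpos (hcQ e he) (hwQ e he).le).1 hb0 e he
        exact (mul_eq_zero.1 this).resolve_right (hwQ e he).ne
      have : x = ∑ e ∈ P, c e • fun i => (e i : ℝ) := by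
        ext i
        rw [hx, hsplit, Finset.sum_eq_zero (s := Q) fun e he => by rw [hz e he, zero_mul]]
        simp [Finset.sum_apply]
      rw [this]
      exact integerConicalHull_sum _ _ fun e he => integerConicalHull_smul (hcP e he) (hPF e he)
    · have ha0 : 0 < a := by linarith
      -- The fraction `-b / a` of the inner part moves the whole outer part onto the hyperplane; the
      -- rest of the inner part stays.
      have : x = (1 + b / a) • (∑ e ∈ P, c e • fun i => (e i : ℝ)) +
          ∑ q ∈ P ×ˢ Q, (c q.1 * c q.2 / a) • fun i => ((g q i : ℤ) : ℝ) := by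
        ext i
        rw [hx, hsplit]
        simp only [Pi.add_apply, Pi.smul_apply, Finset.sum_apply, smul_eq_mul]
        have h1 : ∑ q ∈ P ×ˢ Q, c q.1 * c q.2 / a * ((g q i : ℤ) : ℝ) =
            a / a * ∑ e ∈ Q, c e * (e i : ℝ) - b / a * ∑ e ∈ P, c e * (e i : ℝ) := by
          have h2 : ∀ q : (m → ℤ) × (m → ℤ), c q.1 * c q.2 / a * ((g q i : ℤ) : ℝ) =
              (c q.1 * w q.1) * (c q.2 * q.2 i) / a - (c q.1 * q.1 i) * (c q.2 * w q.2) / a := by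
            intro q
            simp only [g, w, Pi.sub_apply, Pi.smul_apply, smul_eq_mul, Int.cast_sub, Int.cast_mul]
            ring
          simp_rw [h2, Finset.sum_sub_distrib, ← Finset.sum_div, Finset.sum_product,
            ← Finset.mul_sum, ← Finset.sum_mul]
          rw [← ha, ← hb]
          ring
        rw [h1, div_self ha0.ne']
        ring
      rw [this]
      refine integerConicalHull_add (integerConicalHull_smul ?_ (integerConicalHull_sum _ _
        fun e he => integerConicalHull_smul (hcP e he) (hPF e he)))
        (integerConicalHull_sum _ _ fun q hq => integerConicalHull_smul ?_
          (mem_integerConicalHull (Finset.mem_union_right _ (Finset.mem_image_of_mem _ hq))))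
      · have : 1 + b / a = (a + b) / a := by field_simp
        rw [this]
        exact div_nonneg hsum ha0.le
      · obtain ⟨hp, hq⟩ := Finset.mem_product.1 hq
        exact div_nonneg (mul_nonneg (hcP _ hp) (hcQ _ hq)) ha0.le

/-- Minkowski–Weyl over the integers: start from the whole space, generated by the vectors `±e_i`,
and cut by one half-space at a time. -/
theorem exists_integerConicalHull_eq_halfspaces [Fintype m] {ι : Type*} (s : Finset ι)
    (v : ι → m → ℤ) :
    ∃ F : Finset (m → ℤ), integerConicalHull F = {x | ∀ k ∈ s, 0 ≤ ∑ i, x i * (v k i : ℝ)} := by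
  classical
  induction s using Finset.induction_on with
  | empty => simpa using integerConicalHull_univ
  | insert k s _ ih =>
    obtain ⟨E, hE⟩ := ih
    obtain ⟨F, hF⟩ := integerConicalHull_inter_halfspace E (v k)
    refine ⟨F, ?_⟩
    rw [hF, hE]
    ext x
    simp [and_comm]

/-- The cones `C^A_b` of an integer matrix are generated by integer vectors. -/
theorem exists_isIntegerConicalBasis_signCone [Fintype m] [Fintype n] (A : Matrix m n ℤ)
    (b : m → EReal) :
    ∃ E : Finset (m → ℤ), IsIntegerConicalBasis (signCone (A.map (Int.cast : ℤ → ℝ)) b) E := by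
  classical
  -- Each equation of `pA = 0` becomes two opposite inequalities. A sign condition that is absent
  -- gets the normal vector `0`, which cuts nothing.
  let v : (n × Bool) ⊕ (m × Bool) → m → ℤ := Sum.elim
    (fun j i => if j.2 then A i j.1 else - A i j.1)
    (fun k => if k.2 then (if b k.1 = ⊤ then Pi.single k.1 1 else 0)
      else (if b k.1 = ⊥ then Pi.single k.1 (-1) else 0))
  obtain ⟨F, hF⟩ := exists_integerConicalHull_eq_halfspaces Finset.univ v
  refine ⟨F, Eq.trans ?_ hF.symm⟩
  have hs : ∀ (x : m → ℝ) (k : m) (z : ℤ),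
      ∑ i, x i * ((Pi.single k z : m → ℤ) i : ℝ) = x k * z := by
    intro x k z
    rw [Finset.sum_eq_single k (fun i _ hi => by simp [hi]) (by simp)]
    simp
  ext x
  simp only [signCone, Set.mem_ofPred_eq, Finset.mem_univ, true_implies, Sum.forall, Prod.forall,
    Bool.forall_bool, v, Sum.elim_inl, Sum.elim_inr]
  refine and_congr ?_ (forall_congr' fun k => ?_)
  · rw [funext_iff]
    refine forall_congr' fun j => ?_
    simp only [Matrix.vecMul, dotProduct, Matrix.map_apply, Pi.zero_apply]
    simp [Finset.sum_neg_distrib]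
    constructor
    · intro h; simp [h]
    · rintro ⟨h1, h2⟩; linarith
  · have h1 := hs x k 1
    have h2 := hs x k (-1)
    by_cases ht : b k = ⊤ <;> by_cases hb : b k = ⊥ <;> simp_all

theorem mem_of_isIntegerConicalBasis {C : Set (m → ℝ)} {E : Finset (m → ℤ)}
    (h : IsIntegerConicalBasis C E) {e : m → ℤ} (he : e ∈ E) : (fun i => (e i : ℝ)) ∈ C := by
  rw [show C = integerConicalHull E from h]
  exact mem_integerConicalHull he

theorem signCones_finite [Fintype m] (A : Matrix m n ℝ) : (signCones A).Finite := by
  have h : (Set.pi Set.univ fun _ : m => ({⊥, 0, ⊤} : Set EReal)).Finite :=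
    Set.Finite.pi fun _ => Set.toFinite _
  refine (h.image (signCone A)).subset ?_
  rintro C ⟨b, hb, rfl⟩
  exact ⟨b, fun i _ => by simpa using hb i, rfl⟩

theorem allExtremeDirections_finite [Fintype m] (A : Matrix m n ℝ)
    (ED : Set (m → ℝ) → Finset (m → ℤ)) : (allExtremeDirections A ED).Finite :=
  (signCones_finite A).biUnion fun C _ => (ED C).finite_toSet

theorem exists_isExtremeDirectionChoice [Fintype m] [Fintype n] (A : Matrix m n ℤ) :
    ∃ ED : Set (m → ℝ) → Finset (m → ℤ),
      IsExtremeDirectionChoice (A.map (Int.cast : ℤ → ℝ)) ED := by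
  have h : ∀ C : Set (m → ℝ), ∃ E : Finset (m → ℤ),
      C ∈ signCones (A.map (Int.cast : ℤ → ℝ)) → IsIntegerConicalBasis C E := by
    intro C
    by_cases hC : C ∈ signCones (A.map (Int.cast : ℤ → ℝ))
    · obtain ⟨b, -, rfl⟩ := hC
      obtain ⟨E, hE⟩ := exists_isIntegerConicalBasis_signCone A b
      exact ⟨E, fun _ => hE⟩
    · exact ⟨∅, fun h => absurd h hC⟩
  choose ED hED using h
  exact ⟨ED, hED⟩

theorem vecMul_eq_zero_of_mem_allExtremeDirections [Fintype m] {A : Matrix m n ℝ}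
    {ED : Set (m → ℝ) → Finset (m → ℤ)} (hED : IsExtremeDirectionChoice A ED) {p : m → ℤ}
    (hp : p ∈ allExtremeDirections A ED) : Matrix.vecMul (fun i => (p i : ℝ)) A = 0 := by
  simp only [allExtremeDirections, Set.mem_iUnion, exists_prop] at hp
  obtain ⟨C, hC, hp⟩ := hp
  have h := mem_of_isIntegerConicalBasis (hED C hC) hp
  obtain ⟨b, -, rfl⟩ := hC
  exact h.1

end Cones

/-! ### Polynomial equations, logarithms and separation -/

section PolynomialEquations

variable {m n : Type*} [Fintype m]

/-- Logarithms linearise the equation. Positivity matters only on the support of `p`, since the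
other factors do not occur. -/
theorem polynomialEquation_iff_of_pos {α γ : m → ℝ} {p : m → ℤ}
    (h : ∀ i, p i ≠ 0 → 0 < α i ∧ 0 < γ i) :
    PolynomialEquation α γ p ↔ ∑ i, (p i : ℝ) * (Real.log (α i) - Real.log (γ i)) = 0 := by
  have hP : ∀ i ∈ Finset.univ.filter fun i => 0 < p i, 0 < α i ∧ 0 < γ i := fun i hi =>
    h i (Finset.mem_filter.1 hi).2.ne'
  have hN : ∀ i ∈ Finset.univ.filter fun i => p i < 0, 0 < α i ∧ 0 < γ i := fun i hi =>
    h i (Finset.mem_filter.1 hi).2.ne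
  have hlogP : ∀ f : m → ℝ, (∀ i ∈ Finset.univ.filter fun i => 0 < p i, 0 < f i) →
      Real.log (∏ i with 0 < p i, f i ^ (p i).toNat) =
        ∑ i with 0 < p i, (p i : ℝ) * Real.log (f i) := by
    intro f hf
    rw [Real.log_prod fun i hi => (pow_pos (hf i hi) _).ne']
    refine Finset.sum_congr rfl fun i hi => ?_
    rw [Real.log_pow]
    congr 1
    exact_mod_cast Int.toNat_of_nonneg (Finset.mem_filter.1 hi).2.le
  have hlogN : ∀ f : m → ℝ, (∀ i ∈ Finset.univ.filter fun i => p i < 0, 0 < f i) →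
      Real.log (∏ i with p i < 0, f i ^ (-p i).toNat) =
        -∑ i with p i < 0, (p i : ℝ) * Real.log (f i) := by
    intro f hf
    rw [Real.log_prod fun i hi => (pow_pos (hf i hi) _).ne', ← Finset.sum_neg_distrib]
    refine Finset.sum_congr rfl fun i hi => ?_
    rw [Real.log_pow, ← neg_mul]
    congr 1
    exact_mod_cast Int.toNat_of_nonneg (neg_nonneg.2 (Finset.mem_filter.1 hi).2.le)
  have hprodP : ∀ f : m → ℝ, (∀ i ∈ Finset.univ.filter fun i => 0 < p i, 0 < f i) →
      0 < ∏ i with 0 < p i, f i ^ (p i).toNat := fun f hf =>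
    Finset.prod_pos fun i hi => pow_pos (hf i hi) _
  have hprodN : ∀ f : m → ℝ, (∀ i ∈ Finset.univ.filter fun i => p i < 0, 0 < f i) →
      0 < ∏ i with p i < 0, f i ^ (-p i).toNat := fun f hf =>
    Finset.prod_pos fun i hi => pow_pos (hf i hi) _
  have hsplit : ∀ f : m → ℝ, ∑ i, (p i : ℝ) * f i =
      ∑ i with 0 < p i, (p i : ℝ) * f i + ∑ i with p i < 0, (p i : ℝ) * f i := by
    intro f
    rw [Finset.sum_filter, Finset.sum_filter, ← Finset.sum_add_distrib]
    refine Finset.sum_congr rfl fun i _ => ?_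
    rcases lt_trichotomy (p i) 0 with hi | hi | hi
    · simp [hi, hi.le]
    · simp [hi]
    · simp [hi, hi.le]
  have e1 := hprodP α fun i hi => (hP i hi).1
  have e2 := hprodN γ fun i hi => (hN i hi).2
  have e3 := hprodP γ fun i hi => (hP i hi).2
  have e4 := hprodN α fun i hi => (hN i hi).1
  rw [PolynomialEquation, ← Real.log_injOn_pos.eq_iff (Set.mem_Ioi.2 (mul_pos e1 e2))
    (Set.mem_Ioi.2 (mul_pos e3 e4)), Real.log_mul e1.ne' e2.ne', Real.log_mul e3.ne' e4.ne',
    hlogP α fun i hi => (hP i hi).1, hlogN γ fun i hi => (hN i hi).2,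
    hlogP γ fun i hi => (hP i hi).2, hlogN α fun i hi => (hN i hi).1]
  simp_rw [mul_sub]
  rw [Finset.sum_sub_distrib, hsplit, hsplit]
  constructor <;> intro h <;> linarith

/-- Polynomial equations are preserved under limits. -/
theorem polynomialEquation_of_tendsto {α γ : m → ℝ} {αs γs : ℕ → m → ℝ} {p : m → ℤ}
    (hα : ∀ i, Filter.Tendsto (fun k => αs k i) Filter.atTop (nhds (α i)))
    (hγ : ∀ i, Filter.Tendsto (fun k => γs k i) Filter.atTop (nhds (γ i)))
    (h : ∀ k, PolynomialEquation (αs k) (γs k) p) : PolynomialEquation α γ p := by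
  refine tendsto_nhds_unique
    ((tendsto_finsetProd _ fun i _ => (hα i).pow _).mul
      (tendsto_finsetProd _ fun i _ => (hγ i).pow _)) ?_
  simp_rw [show ∀ k, _ = _ from h]
  exact (tendsto_finsetProd _ fun i _ => (hγ i).pow _).mul
      (tendsto_finsetProd _ fun i _ => (hα i).pow _)

/-- A functional separating `T` from the range of `A` is bounded below on a subspace, so it vanishes
there; its negative is `p`. -/
theorem exists_mulVec_mem_or_separating [Fintype n] (A : Matrix m n ℝ) {T : Set (m → ℝ)}
    (hT : Convex ℝ T) (hT' : IsOpen T) :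
    (∃ x, A.mulVec x ∈ T) ∨
      ∃ p, Matrix.vecMul p A = 0 ∧ ∀ y ∈ T, 0 < ∑ i, p i * y i := by
  classical
  by_contra! hcon
  obtain ⟨h1, h2⟩ := hcon
  have hconv : Convex ℝ (Set.range A.mulVec) :=
    (LinearMap.range A.mulVecLin).convex
  obtain ⟨f, u, hfT, hfA⟩ := geometric_hahn_banach_open hT hT' hconv
    (Set.disjoint_left.2 fun y hy ⟨x, hx⟩ => h1 x (hx ▸ hy))
  have hu : u ≤ 0 := by simpa using hfA _ ⟨0, rfl⟩
  have hf0 : ∀ x, f (A.mulVec x) = 0 := by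
    intro x
    by_contra hne
    -- This multiple of `x` has the value `u - 1`, below the bound `u`.
    have h := hfA _ ⟨((u - 1) / f (A.mulVec x)) • x, rfl⟩
    rw [Matrix.mulVec_smul, map_smul, smul_eq_mul, div_mul_cancel₀ _ hne] at h
    linarith
  have hf : ∀ y, f y = ∑ i, y i * f (Pi.single i 1) := by
    intro y
    conv_lhs => rw [pi_eq_sum_univ' y]
    rw [map_sum]
    refine Finset.sum_congr rfl fun i _ => ?_
    rw [map_smul, smul_eq_mul]
  obtain ⟨y, hy, hy'⟩ := h2 (fun i => - f (Pi.single i 1)) (by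
    ext j
    have h := hf0 (Pi.single j 1)
    rw [hf] at h
    simp only [Matrix.mulVec_single_one] at h
    simp only [Matrix.vecMul, dotProduct, neg_mul, Finset.sum_neg_distrib, Pi.zero_apply,
      neg_eq_zero]
    rw [← h]
    exact Finset.sum_congr rfl fun i _ => mul_comm _ _)
  have h3 := hfT y hy
  rw [hf] at h3
  simp only [neg_mul, Finset.sum_neg_distrib] at hy'
  simp_rw [mul_comm] at hy' h3
  linarith

/-- Expanding `p` in the generators of its orthant cone, some term has positive coefficient and
positive product with `y`. -/
theorem exists_conformal_extremeDirection {A : Matrix m n ℝ}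
    {ED : Set (m → ℝ) → Finset (m → ℤ)} (hED : IsExtremeDirectionChoice A ED) {p y : m → ℝ}
    (hp : Matrix.vecMul p A = 0) (hy : 0 < ∑ i, p i * y i) :
    ∃ e ∈ allExtremeDirections A ED, 0 < ∑ i, (e i : ℝ) * y i ∧
      ∀ i, (0 ≤ p i → 0 ≤ e i) ∧ (p i ≤ 0 → e i ≤ 0) := by
  classical
  let b : m → EReal := fun i => if 0 ≤ p i then ⊤ else ⊥
  have hC : signCone A b ∈ signCones A := by
    refine ⟨b, fun i => ?_, rfl⟩
    by_cases h : 0 ≤ p i <;> simp [b, h]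
  have hpC : p ∈ signCone A b := by
    refine ⟨hp, fun i => ?_⟩
    by_cases h : 0 ≤ p i
    · simp [b, h]
    · simp [b, h, (not_le.1 h).le]
  have hbas := hED _ hC
  obtain ⟨c, hc, hpc⟩ : p ∈ integerConicalHull (ED (signCone A b)) := by
    rw [show signCone A b = _ from hbas] at hpC
    exact hpC
  have hsum : ∑ i, p i * y i = ∑ e ∈ ED (signCone A b), c e * ∑ i, (e i : ℝ) * y i := by
    simp_rw [hpc, Finset.sum_mul, Finset.mul_sum]
    rw [Finset.sum_comm]
    simp_rw [mul_assoc]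
  rw [hsum] at hy
  obtain ⟨e, he, hey⟩ := Finset.exists_lt_of_sum_lt (f := fun _ => (0 : ℝ)) (by simpa using hy)
  have hce : 0 < c e := (hc e he).lt_of_ne fun h => by simp [← h] at hey
  have hsign : ∀ e ∈ ED (signCone A b), ∀ i, (0 ≤ p i → 0 ≤ e i) ∧ (¬ 0 ≤ p i → e i ≤ 0) := by
    intro e he i
    have h := (mem_of_isIntegerConicalBasis hbas he).2 i
    by_cases hi : 0 ≤ p i
    · simpa [b, hi] using h
    · simpa [b, hi] using h
  refine ⟨e, Set.mem_biUnion hC he, pos_of_mul_pos_right hey hce.le, fun i =>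
    ⟨(hsign e he i).1, fun hi => ?_⟩⟩
  rcases hi.eq_or_lt with hi | hi
  -- The cone only gives `e i ≥ 0` here. But `p i = 0` is a sum of non-negative terms, so `e`,
  -- having a positive coefficient, vanishes at `i`.
  · have h0 : ∑ e ∈ ED (signCone A b), c e * (e i : ℝ) = 0 := by rw [← hpc, hi]
    have h1 := (Finset.sum_eq_zero_iff_of_nonneg fun e he => mul_nonneg (hc e he)
      (Int.cast_nonneg ((hsign e he i).1 hi.ge))).1 h0 e he
    have h2 := (mul_eq_zero.1 h1).resolve_left hce.ne'
    exact (Int.cast_eq_zero.1 h2).le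
  · exact (hsign e he i).2 (not_le.2 hi)

/-- The set of values close to `log (a / g)`, where `log 0 = -∞` and `log ∞ = ∞`. -/
def logWindow (a g K ε : ℝ) : Set ℝ :=
  {t | (0 < a → 0 < g → |t - (Real.log a - Real.log g)| < ε) ∧ (0 < a → g = 0 → K < t) ∧
    (a = 0 → 0 < g → t < -K)}

theorem logWindow_eq_of_pos {a g : ℝ} (ha : 0 < a) (hg : 0 < g) (K ε : ℝ) :
    logWindow a g K ε = Metric.ball (Real.log a - Real.log g) ε := by
  ext t
  exact ⟨fun h => h.1 ha hg, fun h =>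
    ⟨fun _ _ => h, fun _ h0 => absurd h0 hg.ne', fun h0 => absurd h0 ha.ne'⟩⟩

theorem logWindow_eq_Ioi {a : ℝ} (ha : 0 < a) (K ε : ℝ) : logWindow a 0 K ε = Set.Ioi K := by
  ext t
  simp [logWindow, ha, ha.ne']

theorem logWindow_eq_Iio {g : ℝ} (hg : 0 < g) (K ε : ℝ) : logWindow 0 g K ε = Set.Iio (-K) := by
  ext t
  simp [logWindow, hg, hg.ne']

theorem logWindow_zero_zero (K ε : ℝ) : logWindow 0 0 K ε = Set.univ := by
  ext t
  simp [logWindow]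

theorem isOpen_convex_logWindow {a g : ℝ} (ha : 0 ≤ a) (hg : 0 ≤ g) (K ε : ℝ) :
    IsOpen (logWindow a g K ε) ∧ Convex ℝ (logWindow a g K ε) := by
  rcases ha.eq_or_lt with rfl | ha <;> rcases hg.eq_or_lt with rfl | hg
  · rw [logWindow_zero_zero]
    exact ⟨isOpen_univ, convex_univ⟩
  · rw [logWindow_eq_Iio hg]
    exact ⟨isOpen_Iio, convex_Iio _⟩
  · rw [logWindow_eq_Ioi ha]
    exact ⟨isOpen_Ioi, convex_Ioi _⟩
  · rw [logWindow_eq_of_pos ha hg]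
    exact ⟨Metric.isOpen_ball, convex_ball _ _⟩

theorem nonneg_of_forall_pos_add_mul {c p : ℝ} (h : ∀ t : ℝ, 0 ≤ t → 0 < c + t * p) : 0 ≤ p := by
  by_contra! hp
  have h1 := h (|c| / -p) (div_nonneg (abs_nonneg c) (by linarith))
  rw [div_mul_eq_mul_div, mul_div_assoc, div_neg, div_self hp.ne] at h1
  linarith [le_abs_self c]

/-- The core of the converse: an obstruction to approximating the log-ratios would be seen by an
extreme direction, whose equation rules it out. -/
theorem exists_mulVec_mem_logWindow [Fintype n] {A : Matrix m n ℝ}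
    {ED : Set (m → ℝ) → Finset (m → ℤ)} (hED : IsExtremeDirectionChoice A ED) {α γ : m → ℝ}
    (hα : ∀ i, 0 ≤ α i) (hγ : ∀ i, 0 ≤ γ i)
    (h : ∀ p ∈ allExtremeDirections A ED, PolynomialEquation α γ p) {K ε : ℝ} (hε : 0 < ε) :
    ∃ x, ∀ i, A.mulVec x i ∈ logWindow (α i) (γ i) K ε := by
  classical
  let T : Set (m → ℝ) := Set.univ.pi fun i => logWindow (α i) (γ i) K ε
  have hTo : IsOpen T := isOpen_set_pi Set.finite_univ fun i _ =>
    (isOpen_convex_logWindow (hα i) (hγ i) K ε).1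
  have hTc : Convex ℝ T := convex_pi fun i _ => (isOpen_convex_logWindow (hα i) (hγ i) K ε).2
  rcases exists_mulVec_mem_or_separating A hTc hTo with ⟨x, hx⟩ | ⟨p, hpA, hp⟩
  · exact ⟨x, fun i => hx i trivial⟩
  exfalso
  let y : m → ℝ := fun i =>
    if 0 < α i then if 0 < γ i then Real.log (α i) - Real.log (γ i) else K + 1
    else if 0 < γ i then -K - 1 else 0
  have hyT : y ∈ T := by
    intro i _
    rcases (hα i).eq_or_lt with ha | ha <;> rcases (hγ i).eq_or_lt with hg | hg
    · simp [← ha, ← hg, logWindow_zero_zero]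
    · simp [← ha, hg, logWindow_eq_Iio, y]
    · simp [ha, ← hg, logWindow_eq_Ioi, y]
    · simp [ha, hg, logWindow_eq_of_pos, y, hε]
  -- Moving `y` along one coordinate inside its window keeps the separating value positive. An
  -- unbounded window thus determines the sign of `p i`.
  have hupd : ∀ i (t : ℝ), y i + t ∈ logWindow (α i) (γ i) K ε →
      0 < ∑ j, p j * y j + t * p i := by
    intro i t ht
    have := hp (y + Pi.single i t) fun j _ => by
      by_cases hj : j = i
      · subst hj; simpa using ht
      · simpa [hj] using hyT j trivial
    simpa [mul_add, Finset.sum_add_distrib, Pi.single_apply, mul_comm] using this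
  have hγ0 : ∀ i, γ i = 0 → 0 ≤ p i := by
    intro i hi
    refine nonneg_of_forall_pos_add_mul fun t ht => hupd i t ?_
    rcases (hα i).eq_or_lt with ha | ha
    · simp [← ha, hi, logWindow_zero_zero]
    · simp only [ha, hi, logWindow_eq_Ioi, y]
      simp
      linarith
  have hα0 : ∀ i, α i = 0 → p i ≤ 0 := by
    intro i hi
    refine neg_nonneg.1 (nonneg_of_forall_pos_add_mul (c := ∑ j, p j * y j) fun t ht => ?_)
    have := hupd i (-t) ?_
    · linarith
    rcases (hγ i).eq_or_lt with hg | hg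
    · simp [← hg, hi, logWindow_zero_zero]
    · simp only [hg, hi, logWindow_eq_Iio, y]
      simp
      linarith
  obtain ⟨e, he, hey, hep⟩ := exists_conformal_extremeDirection hED hpA (hp y hyT)
  have heq := h e he
  have h1 : ∀ i, 0 < e i → 0 < α i := fun i hi => (hα i).lt_of_ne fun h0 =>
    hi.not_ge ((hep i).2 (hα0 i h0.symm))
  have h2 : ∀ i, e i < 0 → 0 < γ i := fun i hi => (hγ i).lt_of_ne fun h0 =>
    hi.not_ge ((hep i).1 (hγ0 i h0.symm))
  -- The signs make every factor on the left of the equation of `e` positive; the equation carries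
  -- this over to the right.
  have hpos : 0 < (∏ i with 0 < e i, γ i ^ (e i).toNat) *
      ∏ i with e i < 0, α i ^ (-e i).toNat := by
    rw [← show _ = _ from heq]
    exact mul_pos (Finset.prod_pos fun i hi => pow_pos (h1 i (Finset.mem_filter.1 hi).2) _)
      (Finset.prod_pos fun i hi => pow_pos (h2 i (Finset.mem_filter.1 hi).2) _)
  have h3 : ∀ i, 0 < e i → 0 < γ i := fun i hi => (hγ i).lt_of_ne fun h0 => by
    refine left_ne_zero_of_mul hpos.ne' (Finset.prod_eq_zero (i := i) (by simp [hi]) ?_)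
    rw [← h0, zero_pow]
    omega
  have h4 : ∀ i, e i < 0 → 0 < α i := fun i hi => (hα i).lt_of_ne fun h0 => by
    refine right_ne_zero_of_mul hpos.ne' (Finset.prod_eq_zero (i := i) (by simp [hi]) ?_)
    rw [← h0, zero_pow]
    omega
  have hsupp : ∀ i, e i ≠ 0 → 0 < α i ∧ 0 < γ i := fun i hi => by
    rcases lt_or_gt_of_ne hi with hi | hi
    · exact ⟨h4 i hi, h2 i hi⟩
    · exact ⟨h1 i hi, h3 i hi⟩
  -- On the support of `e`, `y` is the true log-ratio, so the equation says that `e` is orthogonal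
  -- to `y`.
  refine hey.ne' (Eq.trans (Finset.sum_congr rfl fun i _ => ?_)
    ((polynomialEquation_iff_of_pos hsupp).1 heq))
  by_cases hi : e i = 0
  · simp [hi]
  · simp [y, hsupp i hi]

/-- If the polynomial equations of all extreme directions hold, then the ratios `α i / γ i` can be
approximated simultaneously by exponentials of the entries of vectors in the range of `A`. -/
theorem exists_tendsto_exp_mulVec [Fintype n] {A : Matrix m n ℝ}
    {ED : Set (m → ℝ) → Finset (m → ℤ)} (hED : IsExtremeDirectionChoice A ED) {α γ : m → ℝ}
    (hα : ∀ i, 0 ≤ α i) (hγ : ∀ i, 0 ≤ γ i)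
    (h : ∀ p ∈ allExtremeDirections A ED, PolynomialEquation α γ p) :
    ∃ x : ℕ → n → ℝ, ∀ i,
      (0 < γ i → Filter.Tendsto (fun k => Real.exp (A.mulVec (x k) i)) Filter.atTop
        (nhds (α i / γ i))) ∧
      (0 < α i → Filter.Tendsto (fun k => Real.exp (-A.mulVec (x k) i)) Filter.atTop
        (nhds (γ i / α i))) := by
  -- The bound `k` tends to infinity and the tolerance to zero, so finite and infinite log-ratios
  -- are approached together.
  choose x hx using fun k : ℕ => exists_mulVec_mem_logWindow hED hα hγ h (K := k)
    (ε := 1 / ((k : ℝ) + 1)) (by positivity)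
  have hmid : ∀ i, 0 < α i → 0 < γ i → Filter.Tendsto (fun k => A.mulVec (x k) i) Filter.atTop
      (nhds (Real.log (α i) - Real.log (γ i))) := by
    intro i ha hg
    rw [tendsto_iff_dist_tendsto_zero]
    refine squeeze_zero (fun _ => dist_nonneg) (fun k => ?_) tendsto_one_div_add_atTop_nhds_zero_nat
    rw [Real.dist_eq]
    exact ((hx k i).1 ha hg).le
  refine ⟨x, fun i => ⟨fun hg => ?_, fun ha => ?_⟩⟩
  · rcases (hα i).eq_or_lt with ha | ha
    · rw [← ha, zero_div]
      refine Real.tendsto_exp_atBot.comp (Filter.tendsto_atBot_mono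
        (fun k => ((hx k i).2.2 ha.symm hg).le) ?_)
      exact Filter.tendsto_neg_atTop_atBot.comp tendsto_natCast_atTop_atTop
    · have := (Real.continuous_exp.tendsto _).comp (hmid i ha hg)
      rwa [Real.exp_sub, Real.exp_log ha, Real.exp_log hg] at this
  · rcases (hγ i).eq_or_lt with hg | hg
    · rw [← hg, zero_div]
      refine Real.tendsto_exp_atBot.comp (Filter.tendsto_neg_atTop_atBot.comp
        (Filter.tendsto_atTop_mono (fun k => ((hx k i).2.1 ha hg.symm).le) ?_))
      exact tendsto_natCast_atTop_atTop
    · have := (Real.continuous_exp.tendsto _).comp (hmid i ha hg).neg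
      rwa [neg_sub, Real.exp_sub, Real.exp_log ha, Real.exp_log hg] at this

end PolynomialEquations

namespace ExtensiveGame

variable {N Act : Type*} [Fintype Act] [DecidableEq Act] {G : ExtensiveGame N Act}

/-! ### Moves along histories and perfect recall -/

section Moves

@[simp]
theorem moves_nil : G.moves [] = [] := by simp [moves]

@[simp]
theorem moves_concat (h : List Act) (a : Act) :
    G.moves (h ++ [a]) = G.moves h ++ [(G.infoSets.part h, a)] := by
  refine List.ext_getElem (by simp [moves]) fun k hk _ => ?_
  have hk' : k ≤ h.length := by simpa [moves, Nat.lt_succ_iff] using hk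
  rcases hk'.eq_or_lt with rfl | hk'
  · simp [moves]
  · simp [moves, hk', hk'.le]

@[simp]
theorem length_moves (h : List Act) : (G.moves h).length = h.length := by simp [moves]

theorem moves_prefix {h h' : List Act} (hh : h <+: h') : G.moves h <+: G.moves h' := by
  obtain ⟨t, rfl⟩ := hh
  induction t using List.reverseRecOn with
  | nil => simp
  | append_singleton t a ih =>
    rw [← List.append_assoc, moves_concat]
    exact ih.trans (List.prefix_append _ _)

theorem mem_moves_iff {h : List Act} {I : Finset (List Act)} {a : Act} :
    (I, a) ∈ G.moves h ↔ ∃ t, t ++ [a] <+: h ∧ G.infoSets.part t = I := by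
  induction h using List.reverseRecOn with
  | nil => simp
  | append_singleton h b ih =>
    rw [moves_concat, List.mem_append, ih]
    simp only [List.prefix_concat_iff, List.mem_singleton, Prod.mk.injEq]
    constructor
    · rintro (⟨t, ht, hI⟩ | ⟨rfl, rfl⟩)
      · exact ⟨t, Or.inr ht, hI⟩
      · exact ⟨h, Or.inl rfl, rfl⟩
    · rintro ⟨t, ht | ht, hI⟩
      · obtain ⟨rfl, h2⟩ := List.append_inj' ht rfl
        exact Or.inr ⟨hI.symm, by simpa using h2⟩
      · exact Or.inl ⟨t, ht, hI⟩

theorem mem_nonterminal_iff {h : List Act} :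
    h ∈ G.histories.filter (fun h => ∃ a, h ++ [a] ∈ G.histories) ↔
      ∃ a, h ++ [a] ∈ G.histories := by
  simp only [Finset.mem_filter, and_iff_right_iff_imp]
  rintro ⟨a, ha⟩
  exact G.prefix_mem _ _ ha (List.prefix_append _ _)

theorem part_mem_of_concat {h : List Act} {a : Act} (ha : h ++ [a] ∈ G.histories) :
    G.infoSets.part h ∈ G.infoSets.parts :=
  (Finpartition.part_mem _).2 (mem_nonterminal_iff.2 ⟨a, ha⟩)

theorem mem_part_of_concat {h : List Act} {a : Act} (ha : h ++ [a] ∈ G.histories) :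
    h ∈ G.infoSets.part h :=
  Finpartition.mem_part _ (mem_nonterminal_iff.2 ⟨a, ha⟩)

theorem exists_concat_of_mem {I : Finset (List Act)} (hI : I ∈ G.infoSets.parts) {h : List Act}
    (hh : h ∈ I) : ∃ a, h ++ [a] ∈ G.histories :=
  mem_nonterminal_iff.1 (G.infoSets.subset hI hh)

theorem mem_histories_of_mem {I : Finset (List Act)} (hI : I ∈ G.infoSets.parts) {h : List Act}
    (hh : h ∈ I) : h ∈ G.histories :=
  (Finset.mem_filter.1 (G.infoSets.subset hI hh)).1

theorem mem_actions_iff {I : Finset (List Act)} (hI : I ∈ G.infoSets.parts) {h : List Act}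
    (hh : h ∈ I) {a : Act} : a ∈ G.actions I ↔ h ++ [a] ∈ G.histories := by
  simp only [actions, Finset.mem_filter, Finset.mem_univ, true_and]
  exact ⟨fun ⟨h', hh', ha⟩ => (G.actions_eq I hI h hh h' hh' a).2 ha, fun ha => ⟨h, hh, ha⟩⟩

theorem actions_nonempty {I : Finset (List Act)} (hI : I ∈ G.infoSets.parts) :
    (G.actions I).Nonempty := by
  obtain ⟨h, hh⟩ := G.infoSets.nonempty_of_mem_parts hI
  obtain ⟨a, ha⟩ := exists_concat_of_mem hI hh
  exact ⟨a, (mem_actions_iff hI hh).2 ha⟩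

theorem mem_allActions_iff {m : Finset (List Act) × Act} :
    m ∈ G.allActions ↔ m.1 ∈ G.infoSets.parts ∧ m.2 ∈ G.actions m.1 := by
  simp [allActions]

theorem mem_allActions_of_mem_moves {h : List Act} (hh : h ∈ G.histories)
    {m : Finset (List Act) × Act} (hm : m ∈ G.moves h) : m ∈ G.allActions := by
  obtain ⟨I, a⟩ := m
  obtain ⟨t, ht, rfl⟩ := mem_moves_iff.1 hm
  have hta := G.prefix_mem _ _ hh ht
  exact mem_allActions_iff.2 ⟨part_mem_of_concat hta,
    (mem_actions_iff (part_mem_of_concat hta) (mem_part_of_concat hta)).2 hta⟩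

variable [DecidableEq N]

/-- The sequence of information sets and actions of player `i` along the history `h`. -/
def ownMoves (G : ExtensiveGame N Act) (i : N) (h : List Act) : List (Finset (List Act) × Act) :=
  (G.moves h).filter fun m => G.player m.1 = i

theorem ownMoves_prefix (i : N) {h h' : List Act} (hh : h <+: h') :
    G.ownMoves i h <+: G.ownMoves i h' :=
  (moves_prefix hh).filter _

/-- The own moves of the player grow strictly after one of their information sets. -/
theorem length_ownMoves_lt {I : Finset (List Act)} (hI : I ∈ G.infoSets.parts) {h h' : List Act}
    (hh : h ∈ I) (hlt : h <+: h') (hne : h ≠ h') :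
    (G.ownMoves (G.player I) h).length < (G.ownMoves (G.player I) h').length := by
  obtain ⟨t, rfl⟩ := hlt
  cases t with
  | nil => simp at hne
  | cons a t =>
    have h1 : h ++ [a] <+: h ++ a :: t := ⟨t, by simp⟩
    refine lt_of_lt_of_le ?_ (ownMoves_prefix (G.player I) h1).length_le
    simp [ownMoves, G.infoSets.part_eq_of_mem hI hh]

theorem PerfectRecall.ownMoves_eq (hG : G.PerfectRecall) {I : Finset (List Act)}
    (hI : I ∈ G.infoSets.parts) {h h' : List Act} (hh : h ∈ I) (hh' : h' ∈ I) :
    G.ownMoves (G.player I) h = G.ownMoves (G.player I) h' :=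
  hG I hI h hh h' hh'

/-- A proper extension would contain one more own move of the player, while perfect recall makes the
two records equal. -/
theorem PerfectRecall.eq_of_prefix (hG : G.PerfectRecall) {I : Finset (List Act)}
    (hI : I ∈ G.infoSets.parts) {h h' : List Act} (hh : h ∈ I) (hh' : h' ∈ I) (hp : h <+: h') :
    h = h' := by
  by_contra hne
  have := length_ownMoves_lt hI hh hp hne
  rw [hG.ownMoves_eq hI hh hh'] at this
  exact this.false

theorem PerfectRecall.eq_of_prefix_of_prefix (hG : G.PerfectRecall) {I : Finset (List Act)}
    (hI : I ∈ G.infoSets.parts) {h h' t : List Act} (hh : h ∈ I) (hh' : h' ∈ I) (hp : h <+: t)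
    (hp' : h' <+: t) : h = h' := by
  rcases List.prefix_or_prefix_of_prefix hp hp' with h1 | h1
  · exact hG.eq_of_prefix hI hh hh' h1
  · exact (hG.eq_of_prefix hI hh' hh h1).symm

/-- The matrix records only whether an action is played, whereas `prob` counts multiplicity; no
repetition makes the two agree. -/
theorem PerfectRecall.nodup_moves (hG : G.PerfectRecall) {h : List Act} (hh : h ∈ G.histories) :
    (G.moves h).Nodup := by
  induction h using List.reverseRecOn with
  | nil => simp
  | append_singleton h a ih =>
    rw [moves_concat, List.nodup_append]
    refine ⟨ih (G.prefix_mem _ _ hh (List.prefix_append _ _)), by simp, ?_⟩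
    rintro ⟨I, b⟩ hm m' hm' heq
    rw [List.mem_singleton] at hm'
    subst hm'
    obtain ⟨rfl, rfl⟩ := Prod.mk.inj heq
    obtain ⟨t, ht, htI⟩ := mem_moves_iff.1 hm
    have hp : t <+: h := (List.prefix_append _ _).trans ht
    have htb := G.prefix_mem _ _ (G.prefix_mem _ _ hh (List.prefix_append _ _)) ht
    have hmem := G.mem_part_of_concat htb
    rw [htI] at hmem
    have := hG.eq_of_prefix (part_mem_of_concat hh) hmem (mem_part_of_concat hh) hp
    subst this
    have := ht.length_le
    simp at this

end Moves

end ExtensiveGame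

namespace ExtensiveGame

variable {N Act : Type*} [Fintype Act] [DecidableEq Act] {G : ExtensiveGame N Act}

/-! ### Consistency and the polynomial equations -/

section Consistency

theorem exists_int_systemMatrix (G : ExtensiveGame N Act) (pairs : Finset (List Act × List Act)) :
    ∃ A : Matrix (↥pairs ⊕ ↥G.allActions) ↥G.allActions ℤ,
      G.systemMatrix pairs = A.map (Int.cast : ℤ → ℝ) := by
  refine ⟨Matrix.fromRows (Matrix.of fun q j =>
      if j.1 ∈ G.moves q.1.1 ∧ j.1 ∉ G.moves q.1.2 then 1
      else if j.1 ∉ G.moves q.1.1 ∧ j.1 ∈ G.moves q.1.2 then -1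
      else 0) 1, ?_⟩
  ext (q | k) j
  · simp only [systemMatrix, Matrix.fromRows_apply_inl, Matrix.of_apply, Matrix.map_apply]
    split_ifs <;> simp
  · simp only [systemMatrix, Matrix.fromRows_apply_inr, Matrix.map_apply, Matrix.one_apply]
    split_ifs <;> simp

theorem systemMatrix_mulVec_inr (pairs : Finset (List Act × List Act)) (x : ↥G.allActions → ℝ)
    (j : ↥G.allActions) : (G.systemMatrix pairs).mulVec x (Sum.inr j) = x j := by
  simp [systemMatrix, Matrix.fromRows_mulVec]

theorem prob_concat (β : Finset (List Act) → Act → ℝ) (h : List Act) (a : Act) :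
    G.prob β (h ++ [a]) = G.prob β h * β (G.infoSets.part h) a := by
  simp [prob]

theorem prob_pos_of_pos {β : Finset (List Act) → Act → ℝ} (hβ : ∀ m ∈ G.allActions, 0 < β m.1 m.2)
    {h : List Act} (hh : h ∈ G.histories) : 0 < G.prob β h := by
  refine List.prod_pos fun r hr => ?_
  obtain ⟨m, hm, rfl⟩ := List.mem_map.1 hr
  exact hβ m (mem_allActions_of_mem_moves hh hm)

theorem prob_eq_exp {β : Finset (List Act) → Act → ℝ} (hβ : ∀ m ∈ G.allActions, 0 < β m.1 m.2)
    {h : List Act} (hh : h ∈ G.histories) :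
    G.prob β h = Real.exp (((G.moves h).map fun m => Real.log (β m.1 m.2)).sum) := by
  rw [Real.exp_list_sum, List.map_map, prob]
  congr 1
  refine List.map_congr_left fun m hm => ?_
  simp [Real.exp_log (hβ m (mem_allActions_of_mem_moves hh hm))]

theorem pos_of_prob_pos {β : Finset (List Act) → Act → ℝ} (hβ : G.IsStrategy β)
    (hP : ∀ h ∈ G.histories, 0 < G.prob β h) : ∀ m ∈ G.allActions, 0 < β m.1 m.2 := by
  intro m hm
  obtain ⟨hI, ha⟩ := mem_allActions_iff.1 hm
  obtain ⟨h, hh⟩ := G.infoSets.nonempty_of_mem_parts hI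
  have h1 := hP _ ((mem_actions_iff hI hh).1 ha)
  rw [prob_concat, G.infoSets.part_eq_of_mem hI hh] at h1
  exact ((hβ m.1 hI).1 m.2 ha).lt_of_ne (right_ne_zero_of_mul h1.ne').symm

/-- Consistency from unnormalised positive action weights `exp (y k m)` whose limits are the action
probabilities and whose relative weights of histories converge to the ratios of beliefs. -/
theorem consistent_of_tendsto_exp {β : Finset (List Act) → Act → ℝ}
    {μ : Finset (List Act) → List Act → ℝ} (hβμ : G.IsAssessment β μ)
    (y : ℕ → Finset (List Act) × Act → ℝ)
    (hy : ∀ m ∈ G.allActions, Filter.Tendsto (fun k => Real.exp (y k m)) Filter.atTop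
      (nhds (β m.1 m.2)))
    (hratio : ∀ I ∈ G.infoSets.parts, ∀ h ∈ I, ∀ h' ∈ I, 0 < μ I h' →
      Filter.Tendsto (fun k => Real.exp (((G.moves h).map (y k)).sum -
        ((G.moves h').map (y k)).sum)) Filter.atTop (nhds (μ I h / μ I h'))) :
    G.Consistent β μ := by
  -- These normalisers tend to `∑ β = 1`, so dividing by them changes neither the limits of actions
  -- nor those of ratios of histories.
  let Z : ℕ → Finset (List Act) → ℝ := fun k I => ∑ a ∈ G.actions I, Real.exp (y k (I, a))
  have hZpos : ∀ k, ∀ I ∈ G.infoSets.parts, 0 < Z k I := fun k I hI =>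
    Finset.sum_pos (fun a _ => Real.exp_pos _) (actions_nonempty hI)
  have hZ : ∀ I ∈ G.infoSets.parts, Filter.Tendsto (fun k => Z k I) Filter.atTop (nhds 1) := by
    intro I hI
    rw [← (hβμ.1 I hI).2]
    exact tendsto_finsetSum _ fun a ha => hy (I, a) (mem_allActions_iff.2 ⟨hI, ha⟩)
  let βs : ℕ → Finset (List Act) → Act → ℝ := fun k I a => Real.exp (y k (I, a)) / Z k I
  let μs : ℕ → Finset (List Act) → List Act → ℝ := fun k I h =>
    G.prob (βs k) h / ∑ h' ∈ I, G.prob (βs k) h'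
  let W : ℕ → List Act → ℝ := fun k h => ((G.moves h).map fun m => Z k m.1).prod
  have hβspos : ∀ k, ∀ m ∈ G.allActions, 0 < βs k m.1 m.2 := fun k m hm =>
    div_pos (Real.exp_pos _) (hZpos k _ (mem_allActions_iff.1 hm).1)
  have hprob : ∀ k, ∀ h ∈ G.histories, 0 < G.prob (βs k) h := fun k h hh =>
    prob_pos_of_pos (hβspos k) hh
  have hsum : ∀ k, ∀ I ∈ G.infoSets.parts, 0 < ∑ h' ∈ I, G.prob (βs k) h' := fun k I hI =>
    Finset.sum_pos (fun h hh => hprob k h (mem_histories_of_mem hI hh))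
      (G.infoSets.nonempty_of_mem_parts hI)
  have hW : ∀ h ∈ G.histories, Filter.Tendsto (fun k => W k h) Filter.atTop (nhds 1) := by
    intro h hh
    have := tendsto_list_prod (f := fun (m : Finset (List Act) × Act) k => Z k m.1)
      (x := Filter.atTop) (a := fun _ => (1 : ℝ)) (G.moves h) fun m hm =>
        hZ m.1 (mem_allActions_iff.1 (mem_allActions_of_mem_moves hh hm)).1
    simpa using this
  have hPW : ∀ k h, G.prob (βs k) h = Real.exp (((G.moves h).map (y k)).sum) / W k h := by
    intro k h
    simp only [prob, βs, W, Real.exp_list_sum, List.map_map]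
    generalize G.moves h = l
    induction l with
    | nil => simp
    | cons m l ih => simp [ih, div_mul_div_comm]
  refine ⟨βs, μs, fun k => ⟨fun I hI => ⟨fun a ha => ?_, ?_⟩, fun I hI => ⟨fun h hh => ?_, ?_⟩⟩,
    hprob, fun _ _ _ _ _ => rfl, fun I hI a ha => ?_, fun I hI h hh => ?_⟩
  · exact (hβspos k (I, a) (mem_allActions_iff.2 ⟨hI, ha⟩)).le
  · simp only [βs]
    rw [← Finset.sum_div]
    exact div_self (hZpos k I hI).ne'
  · exact div_nonneg (hprob k h (mem_histories_of_mem hI hh)).le (hsum k I hI).le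
  · simp only [μs]
    rw [← Finset.sum_div]
    exact div_self (hsum k I hI).ne'
  · have := (hy (I, a) (mem_allActions_iff.2 ⟨hI, ha⟩)).div (hZ I hI) one_ne_zero
    rwa [div_one] at this
  -- All histories of `I` are compared with one of positive belief; the Bayesian belief is the
  -- quotient of a ratio by the sum of the ratios.
  · obtain ⟨s, hs, hs0⟩ : ∃ s ∈ I, 0 < μ I s := by
      have h1 := (hβμ.2 I hI).2
      obtain ⟨s, hs, h2⟩ := Finset.exists_lt_of_sum_lt (s := I) (f := fun _ => (0 : ℝ))
        (g := μ I) (by simp [h1])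
      exact ⟨s, hs, h2⟩
    have hr : ∀ t ∈ I, Filter.Tendsto (fun k => G.prob (βs k) t / G.prob (βs k) s) Filter.atTop
        (nhds (μ I t / μ I s)) := by
      intro t ht
      have hth := mem_histories_of_mem hI ht
      have hsh := mem_histories_of_mem hI hs
      have h1 := (hratio I hI t ht s hs hs0).mul ((hW s hsh).div (hW t hth) one_ne_zero)
      rw [div_one, mul_one] at h1
      refine h1.congr fun k => ?_
      rw [hPW, hPW, Real.exp_sub, Pi.div_apply, div_div_div_eq, div_mul_div_comm, mul_comm (W k t)]
    have hrsum : Filter.Tendsto (fun k => ∑ t ∈ I, G.prob (βs k) t / G.prob (βs k) s)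
        Filter.atTop (nhds (1 / μ I s)) := by
      rw [← (hβμ.2 I hI).2, Finset.sum_div]
      exact tendsto_finsetSum _ hr
    have h1 := (hr h hh).div hrsum (one_div_pos.2 hs0).ne'
    rw [div_div_div_cancel_right₀ hs0.ne', div_one] at h1
    refine h1.congr fun k => ?_
    rw [Pi.div_apply, ← Finset.sum_div,
      div_div_div_cancel_right₀ (hprob k s (mem_histories_of_mem hI hs)).ne']

variable [DecidableEq N]

theorem PerfectRecall.sum_moves_eq (hG : G.PerfectRecall) {h : List Act} (hh : h ∈ G.histories)
    (y : Finset (List Act) × Act → ℝ) :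
    ((G.moves h).map y).sum = ∑ j : ↥G.allActions, if j.1 ∈ G.moves h then y j.1 else 0 := by
  rw [← List.sum_toFinset y (hG.nodup_moves hh),
    Finset.sum_coe_sort G.allActions fun m => if m ∈ G.moves h then y m else 0,
    ← Finset.sum_filter]
  refine Finset.sum_congr ?_ fun _ _ => rfl
  ext m
  simp only [List.mem_toFinset, Finset.mem_filter, iff_and_self]
  exact mem_allActions_of_mem_moves hh

theorem PerfectRecall.systemMatrix_mulVec_inl (hG : G.PerfectRecall)
    {pairs : Finset (List Act × List Act)} (q : ↥pairs) (h1 : q.1.1 ∈ G.histories)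
    (h2 : q.1.2 ∈ G.histories) (y : Finset (List Act) × Act → ℝ) :
    (G.systemMatrix pairs).mulVec (fun j => y j.1) (Sum.inl q) =
      ((G.moves q.1.1).map y).sum - ((G.moves q.1.2).map y).sum := by
  rw [hG.sum_moves_eq h1, hG.sum_moves_eq h2, ← Finset.sum_sub_distrib]
  simp only [systemMatrix, Matrix.mulVec, dotProduct, Matrix.fromRows_apply_inl, Matrix.of_apply]
  refine Finset.sum_congr rfl fun j _ => ?_
  by_cases hj1 : j.1 ∈ G.moves q.1.1 <;> by_cases hj2 : j.1 ∈ G.moves q.1.2 <;> simp [hj1, hj2]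

/-- The log-ratio vector is `A` applied to `log β`, so `pA = 0` annihilates it. -/
theorem PerfectRecall.polynomialEquation_of_bayes (hG : G.PerfectRecall)
    {pairs : Finset (List Act × List Act)} (hpairs : G.ListsPairs pairs)
    {β : Finset (List Act) → Act → ℝ} {μ : Finset (List Act) → List Act → ℝ}
    (hβ : G.IsStrategy β) (hP : ∀ h ∈ G.histories, 0 < G.prob β h)
    (hμ : ∀ I ∈ G.infoSets.parts, ∀ h ∈ I, μ I h = G.prob β h / ∑ h' ∈ I, G.prob β h')
    {p : ↥pairs ⊕ ↥G.allActions → ℤ}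
    (hp : Matrix.vecMul (fun i => (p i : ℝ)) (G.systemMatrix pairs) = 0) :
    PolynomialEquation (G.alpha pairs β μ) (G.gamma pairs μ) p := by
  have hβ0 := pos_of_prob_pos hβ hP
  have hsum : ∀ I ∈ G.infoSets.parts, 0 < ∑ h' ∈ I, G.prob β h' := fun I hI =>
    Finset.sum_pos (fun h hh => hP h (mem_histories_of_mem hI hh))
      (G.infoSets.nonempty_of_mem_parts hI)
  have key : ∀ i, 0 < G.alpha pairs β μ i ∧ 0 < G.gamma pairs μ i ∧
      Real.log (G.alpha pairs β μ i) - Real.log (G.gamma pairs μ i) =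
        (G.systemMatrix pairs).mulVec (fun j => Real.log (β j.1.1 j.1.2)) i := by
    rintro (q | j)
    · obtain ⟨I, hI, h1, h2⟩ := hpairs.1 q.1 q.2
      have hh1 := mem_histories_of_mem hI h1
      have hh2 := mem_histories_of_mem hI h2
      have e1 : G.alpha pairs β μ (Sum.inl q) = G.prob β q.1.1 / ∑ h' ∈ I, G.prob β h' := by
        simp only [alpha, Sum.elim_inl]
        rw [G.infoSets.part_eq_of_mem hI h1, hμ I hI _ h1]
      have e2 : G.gamma pairs μ (Sum.inl q) = G.prob β q.1.2 / ∑ h' ∈ I, G.prob β h' := by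
        simp only [gamma, Sum.elim_inl]
        rw [G.infoSets.part_eq_of_mem hI h2, hμ I hI _ h2]
      rw [e1, e2]
      refine ⟨div_pos (hP _ hh1) (hsum I hI), div_pos (hP _ hh2) (hsum I hI), ?_⟩
      rw [hG.systemMatrix_mulVec_inl q hh1 hh2 fun m => Real.log (β m.1 m.2),
        Real.log_div (hP _ hh1).ne' (hsum I hI).ne', Real.log_div (hP _ hh2).ne' (hsum I hI).ne',
        prob_eq_exp hβ0 hh1, prob_eq_exp hβ0 hh2, Real.log_exp, Real.log_exp]
      ring
    · rw [systemMatrix_mulVec_inr]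
      simpa [alpha, gamma] using hβ0 j.1 j.2
  rw [polynomialEquation_iff_of_pos fun i _ => ⟨(key i).1, (key i).2.1⟩]
  simp_rw [fun i => (key i).2.2]
  have := Matrix.dotProduct_mulVec (fun i => (p i : ℝ)) (G.systemMatrix pairs)
    fun j => Real.log (β j.1.1 j.1.2)
  rw [hp, zero_dotProduct] at this
  exact this

theorem PerfectRecall.polynomialEquation_of_consistent (hG : G.PerfectRecall)
    {pairs : Finset (List Act × List Act)} (hpairs : G.ListsPairs pairs)
    {β : Finset (List Act) → Act → ℝ} {μ : Finset (List Act) → List Act → ℝ}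
    (hc : G.Consistent β μ) {p : ↥pairs ⊕ ↥G.allActions → ℤ}
    (hp : Matrix.vecMul (fun i => (p i : ℝ)) (G.systemMatrix pairs) = 0) :
    PolynomialEquation (G.alpha pairs β μ) (G.gamma pairs μ) p := by
  obtain ⟨βs, μs, hass, hpos, hbayes, hβ, hμ⟩ := hc
  refine polynomialEquation_of_tendsto (αs := fun k => G.alpha pairs (βs k) (μs k))
    (γs := fun k => G.gamma pairs (μs k)) ?_ ?_ fun k =>
    hG.polynomialEquation_of_bayes hpairs (hass k).1 (hpos k) (hbayes k) hp
  · rintro (q | j)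
    · obtain ⟨I, hI, h1, -⟩ := hpairs.1 q.1 q.2
      simp only [alpha, Sum.elim_inl, G.infoSets.part_eq_of_mem hI h1]
      exact hμ I hI _ h1
    · obtain ⟨hI, ha⟩ := mem_allActions_iff.1 j.2
      exact hβ _ hI _ ha
  · rintro (q | j)
    · obtain ⟨I, hI, -, h2⟩ := hpairs.1 q.1 q.2
      simp only [gamma, Sum.elim_inl, G.infoSets.part_eq_of_mem hI h2]
      exact hμ I hI _ h2
    · exact tendsto_const_nhds

theorem PerfectRecall.consistent_of_polynomialEquation (hG : G.PerfectRecall)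
    {pairs : Finset (List Act × List Act)} (hpairs : G.ListsPairs pairs)
    {ED : Set (↥pairs ⊕ ↥G.allActions → ℝ) → Finset (↥pairs ⊕ ↥G.allActions → ℤ)}
    (hED : IsExtremeDirectionChoice (G.systemMatrix pairs) ED)
    {β : Finset (List Act) → Act → ℝ} {μ : Finset (List Act) → List Act → ℝ}
    (hβμ : G.IsAssessment β μ)
    (h : ∀ p ∈ allExtremeDirections (G.systemMatrix pairs) ED,
      PolynomialEquation (G.alpha pairs β μ) (G.gamma pairs μ) p) : G.Consistent β μ := by
  have hα : ∀ i, 0 ≤ G.alpha pairs β μ i := by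
    rintro (q | j)
    · obtain ⟨I, hI, h1, -⟩ := hpairs.1 q.1 q.2
      simp only [alpha, Sum.elim_inl, G.infoSets.part_eq_of_mem hI h1]
      exact (hβμ.2 I hI).1 _ h1
    · obtain ⟨hI, ha⟩ := mem_allActions_iff.1 j.2
      exact (hβμ.1 _ hI).1 _ ha
  have hγ : ∀ i, 0 ≤ G.gamma pairs μ i := by
    rintro (q | j)
    · obtain ⟨I, hI, -, h2⟩ := hpairs.1 q.1 q.2
      simp only [gamma, Sum.elim_inl, G.infoSets.part_eq_of_mem hI h2]
      exact (hβμ.2 I hI).1 _ h2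
    · simp [gamma]
  obtain ⟨x, hx⟩ := exists_tendsto_exp_mulVec hED hα hγ h
  let y : ℕ → Finset (List Act) × Act → ℝ := fun k m => if hm : m ∈ G.allActions then x k ⟨m, hm⟩
    else 0
  have hxy : ∀ k, x k = fun j : ↥G.allActions => y k j.1 := fun k => by
    ext j
    simp [y]
  refine consistent_of_tendsto_exp hβμ y (fun m hm => ?_) fun I hI h1 hh1 h2 hh2 h0 => ?_
  · have := (hx (Sum.inr ⟨m, hm⟩)).1 (by simp [gamma])
    simp only [systemMatrix_mulVec_inr] at this
    simpa [alpha, gamma, y, hm] using this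
  · by_cases hne : h1 = h2
    · subst hne
      simp [div_self h0.ne']
    have e1 := mem_histories_of_mem hI hh1
    have e2 := mem_histories_of_mem hI hh2
    -- The listed order decides whether `h2`, whose belief is positive, supplies `γ` or `α`, hence
    -- which of the two limits applies.
    rcases hpairs.2 I hI h1 hh1 h2 hh2 hne with hq | hq
    · have := (hx (Sum.inl ⟨_, hq⟩)).1 (by simpa [gamma, G.infoSets.part_eq_of_mem hI hh2] using h0)
      simp_rw [hxy, hG.systemMatrix_mulVec_inl ⟨_, hq⟩ e1 e2] at this
      simpa only [alpha, gamma, Sum.elim_inl, G.infoSets.part_eq_of_mem hI hh1,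
        G.infoSets.part_eq_of_mem hI hh2] using this
    · have := (hx (Sum.inl ⟨_, hq⟩)).2 (by simpa [alpha, G.infoSets.part_eq_of_mem hI hh2] using h0)
      simp_rw [hxy, hG.systemMatrix_mulVec_inl ⟨_, hq⟩ e2 e1, neg_sub] at this
      simpa only [alpha, gamma, Sum.elim_inl, G.infoSets.part_eq_of_mem hI hh1,
        G.infoSets.part_eq_of_mem hI hh2] using this

end Consistency

end ExtensiveGame

namespace ExtensiveGame

variable {N Act : Type*} [Fintype Act] [DecidableEq Act] {G : ExtensiveGame N Act}

/-! ### Deviations and the one-shot deviation principle -/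

section Deviations

theorem exists_of_mem_drop_moves {h h' : List Act} (hp : h <+: h')
    {m : Finset (List Act) × Act} (hm : m ∈ (G.moves h').drop h.length) :
    ∃ t, h <+: t ∧ t ++ [m.2] <+: h' ∧ G.infoSets.part t = m.1 := by
  obtain ⟨s, rfl⟩ := hp
  induction s using List.reverseRecOn with
  | nil =>
    rw [List.append_nil, ← G.length_moves h, List.drop_length] at hm
    simp at hm
  | append_singleton s a ih =>
    rw [← List.append_assoc, moves_concat, List.drop_append_of_le_length (by simp),
      List.mem_append] at hm
    rcases hm with hm | hm
    · obtain ⟨t, h1, h2, h3⟩ := ih hm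
      refine ⟨t, h1, h2.trans ?_, h3⟩
      rw [← List.append_assoc]
      exact List.prefix_append _ _
    · rw [List.mem_singleton] at hm
      subst hm
      exact ⟨h ++ s, List.prefix_append _ _, by simp, rfl⟩

theorem condProb_of_not_prefix (β : Finset (List Act) → Act → ℝ) {h h' : List Act}
    (hp : ¬ h <+: h') : G.condProb β h' h = 0 := if_neg hp

theorem condProb_congr {β β' : Finset (List Act) → Act → ℝ} {h h' : List Act}
    (hβ : ∀ t a, h <+: t → t ++ [a] <+: h' →
      β (G.infoSets.part t) a = β' (G.infoSets.part t) a) :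
    G.condProb β h' h = G.condProb β' h' h := by
  by_cases hp : h <+: h'
  · rw [condProb, condProb, if_pos hp, if_pos hp]
    congr 1
    refine List.map_congr_left fun m hm => ?_
    obtain ⟨t, h1, h2, h3⟩ := exists_of_mem_drop_moves hp hm
    rw [← h3]
    exact hβ t m.2 h1 h2
  · rw [condProb_of_not_prefix _ hp, condProb_of_not_prefix _ hp]

theorem condProb_trans (β : Finset (List Act) → Act → ℝ) {h h' h'' : List Act}
    (hp : h <+: h') (hp' : h' <+: h'') :
    G.condProb β h'' h = G.condProb β h' h * G.condProb β h'' h' := by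
  obtain ⟨t, ht⟩ := G.moves_prefix hp'
  rw [condProb, condProb, condProb, if_pos hp, if_pos hp', if_pos (hp.trans hp'),
    ← ht, List.drop_append_of_le_length (by simpa using hp.length_le), List.map_append,
    List.prod_append, ← G.length_moves h', List.drop_left]

theorem condProb_concat (β : Finset (List Act) → Act → ℝ) (h : List Act) (a : Act) :
    G.condProb β (h ++ [a]) h = β (G.infoSets.part h) a := by
  rw [condProb, if_pos (List.prefix_append _ _), moves_concat, ← G.length_moves h, List.drop_left]
  simp

theorem believedUtility_eq (i : N) (β : Finset (List Act) → Act → ℝ)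
    (μ : Finset (List Act) → List Act → ℝ) (I : Finset (List Act)) :
    G.believedUtility i β μ I = ∑ h ∈ I, μ I h * G.expectedUtility i β h := by
  simp_rw [believedUtility, expectedUtility, Finset.mul_sum]
  rw [Finset.sum_comm]
  refine Finset.sum_congr rfl fun h _ => Finset.sum_congr rfl fun z _ => ?_
  ring

theorem mem_histories_of_mem_terminals {z : List Act} (hz : z ∈ G.terminals) :
    z ∈ G.histories := (Finset.mem_filter.1 hz).1

theorem expectedUtility_congr (i : N) {β β' : Finset (List Act) → Act → ℝ} {h : List Act}
    (hβ : ∀ t a, h <+: t → t ++ [a] ∈ G.histories →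
      β (G.infoSets.part t) a = β' (G.infoSets.part t) a) :
    G.expectedUtility i β h = G.expectedUtility i β' h := by
  refine Finset.sum_congr rfl fun z hz => ?_
  rw [condProb_congr fun t a h1 h2 => hβ t a h1
    (G.prefix_mem _ _ (mem_histories_of_mem_terminals hz) h2)]

theorem concat_mem_allActions {t : List Act} {a : Act} (ht : t ++ [a] ∈ G.histories) :
    (G.infoSets.part t, a) ∈ G.allActions :=
  mem_allActions_of_mem_moves ht (by simp)

theorem believedUtility_congr (i : N) {β β' : Finset (List Act) → Act → ℝ}
    (μ : Finset (List Act) → List Act → ℝ) (I : Finset (List Act))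
    (hβ : ∀ m ∈ G.allActions, β m.1 m.2 = β' m.1 m.2) :
    G.believedUtility i β μ I = G.believedUtility i β' μ I := by
  rw [believedUtility_eq, believedUtility_eq]
  refine Finset.sum_congr rfl fun h _ => ?_
  rw [expectedUtility_congr i fun t a _ h2 => hβ (_, a) (concat_mem_allActions h2)]

theorem expectedUtility_eq_sum_actions (i : N) (β : Finset (List Act) → Act → ℝ)
    {J : Finset (List Act)} (hJ : J ∈ G.infoSets.parts) {h : List Act} (hh : h ∈ J) :
    G.expectedUtility i β h = ∑ a ∈ G.actions J, β J a * G.expectedUtility i β (h ++ [a]) := by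
  simp_rw [expectedUtility, Finset.mul_sum]
  rw [Finset.sum_comm]
  refine Finset.sum_congr rfl fun z hz => ?_
  simp_rw [mul_left_comm (β J _), ← Finset.mul_sum]
  congr 1
  by_cases hp : h <+: z
  · obtain ⟨s, rfl⟩ := hp
    cases s with
    | nil =>
      rw [List.append_nil] at hz
      exact absurd (exists_concat_of_mem hJ hh) (Finset.mem_filter.1 hz).2
    | cons b s =>
      have hb : h ++ [b] <+: h ++ b :: s := ⟨s, by simp⟩
      have hbJ : b ∈ G.actions J := (mem_actions_iff hJ hh).2
        (G.prefix_mem _ _ (mem_histories_of_mem_terminals hz) hb)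
      rw [Finset.sum_eq_single_of_mem b hbJ fun a _ hab => ?_,
        condProb_trans β (List.prefix_append h [b]) hb, condProb_concat,
        G.infoSets.part_eq_of_mem hJ hh]
      rw [condProb_of_not_prefix, mul_zero]
      intro h1
      have := List.prefix_of_prefix_length_le h1 hb (by simp)
      simp at this
      exact hab this
  · rw [condProb_of_not_prefix _ hp, Finset.sum_eq_zero fun a _ => ?_]
    rw [condProb_of_not_prefix _ fun h1 => hp ((List.prefix_append _ _).trans h1), mul_zero]

theorem believedUtility_eq_sum_actions (i : N) (β : Finset (List Act) → Act → ℝ)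
    (μ : Finset (List Act) → List Act → ℝ) {J : Finset (List Act)} (hJ : J ∈ G.infoSets.parts) :
    G.believedUtility i β μ J =
      ∑ a ∈ G.actions J, β J a * ∑ h ∈ J, μ J h * G.expectedUtility i β (h ++ [a]) := by
  rw [believedUtility_eq, Finset.sum_congr rfl fun h hh => by
    rw [expectedUtility_eq_sum_actions i β hJ hh]]
  simp_rw [Finset.mul_sum]
  rw [Finset.sum_comm]
  refine Finset.sum_congr rfl fun a _ => Finset.sum_congr rfl fun h _ => ?_
  ring

theorem condProb_nonneg {β : Finset (List Act) → Act → ℝ} (hβ : G.IsStrategy β) {h h' : List Act}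
    (hh' : h' ∈ G.histories) : 0 ≤ G.condProb β h' h := by
  rw [condProb]
  split_ifs
  · refine List.prod_nonneg fun r hr => ?_
    obtain ⟨m, hm, rfl⟩ := List.mem_map.1 hr
    obtain ⟨h1, h2⟩ := mem_allActions_iff.1
      (mem_allActions_of_mem_moves hh' (List.mem_of_mem_drop hm))
    exact (hβ _ h1).1 _ h2
  · exact le_rfl

theorem tendsto_condProb {β : Finset (List Act) → Act → ℝ}
    {βs : ℕ → Finset (List Act) → Act → ℝ}
    (hβ : ∀ m ∈ G.allActions, Filter.Tendsto (fun k => βs k m.1 m.2) Filter.atTop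
      (nhds (β m.1 m.2))) {h h' : List Act} (hh' : h' ∈ G.histories) :
    Filter.Tendsto (fun k => G.condProb (βs k) h' h) Filter.atTop (nhds (G.condProb β h' h)) := by
  simp only [condProb]
  split_ifs
  · exact tendsto_list_prod (f := fun (m : Finset (List Act) × Act) k => βs k m.1 m.2) _
      fun m hm => hβ m (mem_allActions_of_mem_moves hh' (List.mem_of_mem_drop hm))
  · exact tendsto_const_nhds

variable [DecidableEq N]

/-- The effect of a deviation at a single information set `J`. -/
theorem PerfectRecall.expectedUtility_sub (hG : G.PerfectRecall) (i : N)
    {σ σ' : Finset (List Act) → Act → ℝ} {J : Finset (List Act)} (hJ : J ∈ G.infoSets.parts)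
    (hσ : ∀ m ∈ G.allActions, m.1 ≠ J → σ m.1 m.2 = σ' m.1 m.2) (h : List Act) :
    G.expectedUtility i σ' h - G.expectedUtility i σ h =
      ∑ h' ∈ J, G.condProb σ h' h * (G.expectedUtility i σ' h' - G.expectedUtility i σ h') := by
  simp_rw [expectedUtility, ← Finset.sum_sub_distrib, Finset.mul_sum]
  rw [Finset.sum_comm]
  refine Finset.sum_congr rfl fun z hz => ?_
  simp_rw [← mul_sub, mul_left_comm _ (G.utility i z), ← Finset.mul_sum]
  congr 1
  have hzh := mem_histories_of_mem_terminals hz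
  -- By perfect recall, at most one history of `J` lies on the way to `z`. Before it the two
  -- profiles coincide; without it they coincide all the way.
  by_cases hex : ∃ h₀ ∈ J, h <+: h₀ ∧ h₀ <+: z
  · obtain ⟨h₀, hJ₀, hp, hpz⟩ := hex
    rw [Finset.sum_eq_single_of_mem h₀ hJ₀ fun h' hh' hne => ?_, condProb_trans σ hp hpz,
      condProb_trans σ' hp hpz, condProb_congr (β := σ') (β' := σ) fun t a _ h2 => ?_]
    · ring
    · have ht := G.prefix_mem _ _ (G.prefix_mem _ _ hzh hpz) h2
      refine (hσ (_, a) (concat_mem_allActions ht) fun htJ => ?_).symm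
      have := hG.eq_of_prefix hJ (htJ ▸ mem_part_of_concat ht) hJ₀
        ((List.prefix_append _ _).trans h2)
      subst this
      simpa using h2.length_le
    · have hnp : ¬ h' <+: z := fun h1 => hne (hG.eq_of_prefix_of_prefix hJ hh' hJ₀ h1 hpz)
      rw [condProb_of_not_prefix _ hnp, condProb_of_not_prefix _ hnp, sub_zero, mul_zero]
  · push Not at hex
    rw [Finset.sum_eq_zero fun h' hh' => ?_, condProb_congr (β := σ') (β' := σ) fun t a h1 h2 => ?_,
      sub_self]
    · have ht := G.prefix_mem _ _ hzh h2
      refine (hσ (_, a) (concat_mem_allActions ht) fun htJ => ?_).symm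
      exact hex t (htJ ▸ mem_part_of_concat ht) h1 ((List.prefix_append _ _).trans h2)
    · by_cases hp : h <+: h'
      · have hnp := hex h' hh' hp
        rw [condProb_of_not_prefix _ hnp, condProb_of_not_prefix _ hnp, sub_zero, mul_zero]
      · rw [condProb_of_not_prefix _ hp, zero_mul]

/-- If the weights induced at `J` from `I` are `l` times the beliefs there, a change at `J` is felt
at `I` scaled by `l`. -/
theorem PerfectRecall.believedUtility_sub (hG : G.PerfectRecall) (i : N)
    {σ σ' : Finset (List Act) → Act → ℝ} (μ : Finset (List Act) → List Act → ℝ)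
    {I J : Finset (List Act)} (hJ : J ∈ G.infoSets.parts)
    (hσ : ∀ m ∈ G.allActions, m.1 ≠ J → σ m.1 m.2 = σ' m.1 m.2) {l : ℝ}
    (hl : ∀ h' ∈ J, ∑ h ∈ I, μ I h * G.condProb σ h' h = l * μ J h') :
    G.believedUtility i σ' μ I - G.believedUtility i σ μ I =
      l * (G.believedUtility i σ' μ J - G.believedUtility i σ μ J) := by
  simp_rw [believedUtility_eq, ← Finset.sum_sub_distrib, ← mul_sub]
  rw [Finset.sum_congr rfl fun h _ => by
    rw [hG.expectedUtility_sub i hJ hσ h, Finset.mul_sum], Finset.sum_comm, Finset.mul_sum]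
  refine Finset.sum_congr rfl fun h' hh' => ?_
  simp_rw [← mul_assoc, ← Finset.sum_mul, hl h' hh']

/-- A passage through `I` before `J` is recorded among the own moves, and this record is shared by
all of `J`. -/
theorem PerfectRecall.exists_prefix_of_mem (hG : G.PerfectRecall) {I J : Finset (List Act)}
    (hI : I ∈ G.infoSets.parts) (hJ : J ∈ G.infoSets.parts) (hIJ : G.player I = G.player J)
    {h h' h'' : List Act} (hh : h ∈ I) (hh' : h' ∈ J) (hh'' : h'' ∈ J) (hp : h <+: h') :
    ∃ k ∈ I, k <+: h'' := by
  obtain ⟨s, rfl⟩ := hp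
  cases s with
  | nil =>
    rw [List.append_nil] at hh'
    obtain rfl := G.infoSets.eq_of_mem_parts hI hJ hh hh'
    exact ⟨h'', hh'', List.prefix_rfl⟩
  | cons a s =>
    have h1 : (I, a) ∈ G.ownMoves (G.player J) (h ++ a :: s) := by
      refine List.mem_filter.2 ⟨mem_moves_iff.2
        ⟨h, ⟨s, by simp⟩, G.infoSets.part_eq_of_mem hI hh⟩, by simp [hIJ]⟩
    rw [hG.ownMoves_eq hJ hh' hh''] at h1
    obtain ⟨t, ht, htI⟩ := mem_moves_iff.1 (List.mem_filter.1 h1).1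
    exact ⟨t, htI ▸ mem_part_of_concat (G.prefix_mem _ _ (mem_histories_of_mem hJ hh'') ht),
      (List.prefix_append _ _).trans ht⟩

theorem prod_map_filter_mul_prod_map_filter_not {ι M : Type*} [CommMonoid M] (l : List ι)
    (p : ι → Bool) (f : ι → M) :
    ((l.filter p).map f).prod * ((l.filter fun i => !p i).map f).prod = (l.map f).prod := by
  induction l with
  | nil => simp
  | cons a l ih =>
    by_cases ha : p a
    · simp [ha, ← ih, mul_assoc]
    · simp [ha, ← ih, mul_left_comm]

/-- The probabilities of two histories of `J` are exchanged, when player `i` deviates after `I`. -/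
theorem PerfectRecall.prob_mul_condProb_mul_prob (hG : G.PerfectRecall) {I J : Finset (List Act)}
    (hI : I ∈ G.infoSets.parts) (hJ : J ∈ G.infoSets.parts) (hIJ : G.player I = G.player J)
    {β σ : Finset (List Act) → Act → ℝ}
    (hσ : ∀ m ∈ G.allActions, G.player m.1 ≠ G.player J → σ m.1 m.2 = β m.1 m.2)
    {h k h' h'' : List Act} (hh : h ∈ I) (hk : k ∈ I) (hh' : h' ∈ J) (hh'' : h'' ∈ J)
    (hp : h <+: h') (hp' : k <+: h'') :
    G.prob β h * G.condProb σ h' h * G.prob β h'' =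
      G.prob β k * G.condProb σ h'' k * G.prob β h' := by
  obtain ⟨t, ht⟩ := G.moves_prefix hp
  obtain ⟨s, hs⟩ := G.moves_prefix hp'
  have e1 : (G.moves h').drop h.length = t := by rw [← ht, ← G.length_moves h, List.drop_left]
  have e2 : (G.moves h'').drop k.length = s := by rw [← hs, ← G.length_moves k, List.drop_left]
  have hown : (G.moves h).filter (fun m => G.player m.1 = G.player J) =
      (G.moves k).filter (fun m => G.player m.1 = G.player J) := hIJ ▸ hG I hI h hh k hk
  have hown' := hG J hJ h' hh' h'' hh''
  -- The records agree at `I` and at `J`, hence so do the own moves in between. The deviating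
  -- factors are thus the same on both paths; the others follow `β`.
  have hts : t.filter (fun m => G.player m.1 = G.player J) =
      s.filter (fun m => G.player m.1 = G.player J) := by
    rw [← ht, ← hs, List.filter_append, List.filter_append, hown] at hown'
    exact List.append_cancel_left hown'
  have hoff : ∀ l : List (Finset (List Act) × Act), (∀ m ∈ l, m ∈ G.allActions) →
      (l.filter fun m => !decide (G.player m.1 = G.player J)).map (fun m => σ m.1 m.2) =
      (l.filter fun m => !decide (G.player m.1 = G.player J)).map (fun m => β m.1 m.2) := by
    intro l hl
    refine List.map_congr_left fun m hm => ?_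
    obtain ⟨hm, hm'⟩ := List.mem_filter.1 hm
    exact hσ m (hl m hm) (by simpa using hm')
  have hofft := hoff t fun m hm => mem_allActions_of_mem_moves (mem_histories_of_mem hJ hh')
    (ht ▸ List.mem_append_right _ hm)
  have hoffs := hoff s fun m hm => mem_allActions_of_mem_moves (mem_histories_of_mem hJ hh'')
    (hs ▸ List.mem_append_right _ hm)
  rw [condProb, condProb, if_pos hp, if_pos hp', e1, e2, prob, prob, prob, prob, ← ht, ← hs,
    List.map_append, List.map_append, List.prod_append, List.prod_append]
  have hsplit := fun l : List (Finset (List Act) × Act) => fun τ : Finset (List Act) → Act → ℝ =>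
    prod_map_filter_mul_prod_map_filter_not l (fun m => decide (G.player m.1 = G.player J))
      (fun m => τ m.1 m.2)
  rw [← hsplit t σ, ← hsplit s σ, ← hsplit t β, ← hsplit s β, hofft, hoffs, hts]
  ring

/-- Proportionality of induced weights and beliefs at `J`, cross-multiplied so that it passes to
limits in which beliefs vanish. -/
theorem PerfectRecall.sum_belief_mul_condProb_mul (hG : G.PerfectRecall) {I J : Finset (List Act)}
    (hI : I ∈ G.infoSets.parts) (hJ : J ∈ G.infoSets.parts) (hIJ : G.player I = G.player J)
    {β σ : Finset (List Act) → Act → ℝ} {μ : Finset (List Act) → List Act → ℝ}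
    (hμ : ∀ I ∈ G.infoSets.parts, ∀ h ∈ I, μ I h = G.prob β h / ∑ h' ∈ I, G.prob β h')
    (hσ : ∀ m ∈ G.allActions, G.player m.1 ≠ G.player J → σ m.1 m.2 = β m.1 m.2)
    {h' h'' : List Act} (hh' : h' ∈ J) (hh'' : h'' ∈ J) :
    (∑ h ∈ I, μ I h * G.condProb σ h' h) * μ J h'' =
      (∑ h ∈ I, μ I h * G.condProb σ h'' h) * μ J h' := by
  have hsingle : ∀ {k t : List Act}, k ∈ I → k <+: t →
      ∑ h ∈ I, μ I h * G.condProb σ t h = μ I k * G.condProb σ t k := fun {k t} hk hp =>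
    Finset.sum_eq_single_of_mem k hk fun h hh hne => by
      rw [condProb_of_not_prefix _ fun h1 => hne (hG.eq_of_prefix_of_prefix hI hh hk h1 hp),
        mul_zero]
  by_cases hex : ∃ h ∈ I, h <+: h'
  · obtain ⟨h, hh, hp⟩ := hex
    obtain ⟨k, hk, hp'⟩ := hG.exists_prefix_of_mem hI hJ hIJ hh hh' hh'' hp
    have := hG.prob_mul_condProb_mul_prob hI hJ hIJ hσ hh hk hh' hh'' hp hp'
    rw [hsingle hh hp, hsingle hk hp', hμ I hI h hh, hμ I hI k hk, hμ J hJ h' hh', hμ J hJ h'' hh'',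
      div_mul_eq_mul_div, div_mul_eq_mul_div (G.prob β k), div_mul_div_comm, div_mul_div_comm, this]
  · have hz : ∀ t ∈ J, ∑ h ∈ I, μ I h * G.condProb σ t h = 0 := fun t ht =>
      Finset.sum_eq_zero fun h hh => by
        rw [condProb_of_not_prefix _ fun hp => hex
          (hG.exists_prefix_of_mem hI hJ hIJ hh ht hh' hp), mul_zero]
    rw [hz h' hh', hz h'' hh'', zero_mul, zero_mul]

/-- Under a consistent assessment, the beliefs at `J` are those derived from the beliefs at an
earlier information set of the same player, whatever strategy this player uses. -/
theorem PerfectRecall.exists_belief_factor (hG : G.PerfectRecall) {I J : Finset (List Act)}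
    (hI : I ∈ G.infoSets.parts) (hJ : J ∈ G.infoSets.parts) (hIJ : G.player I = G.player J)
    {β σ : Finset (List Act) → Act → ℝ} {μ : Finset (List Act) → List Act → ℝ}
    (hμ : G.IsBeliefSystem μ) (hc : G.Consistent β μ) (hσs : G.IsStrategy σ)
    (hσ : ∀ m ∈ G.allActions, G.player m.1 ≠ G.player J → σ m.1 m.2 = β m.1 m.2) :
    ∃ l : ℝ, 0 ≤ l ∧ ∀ h' ∈ J, ∑ h ∈ I, μ I h * G.condProb σ h' h = l * μ J h' := by
  obtain ⟨βs, μs, hass, hpos, hbayes, hβs, hμs⟩ := hc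
  -- The player keeps `σ` while the others follow the approximating profile, as the Bayesian
  -- identity requires.
  let σs : ℕ → Finset (List Act) → Act → ℝ := fun k K a =>
    if G.player K = G.player J then σ K a else βs k K a
  have hσlim : ∀ m ∈ G.allActions, Filter.Tendsto (fun k => σs k m.1 m.2) Filter.atTop
      (nhds (σ m.1 m.2)) := by
    intro m hm
    by_cases hmJ : G.player m.1 = G.player J
    · simp [σs, hmJ]
    · simp only [σs, if_neg hmJ, hσ m hm hmJ]
      obtain ⟨h1, h2⟩ := mem_allActions_iff.1 hm
      exact hβs _ h1 _ h2
  have hw : ∀ h' ∈ J, Filter.Tendsto (fun k => ∑ h ∈ I, μs k I h * G.condProb (σs k) h' h)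
      Filter.atTop (nhds (∑ h ∈ I, μ I h * G.condProb σ h' h)) := fun h' hh' =>
    tendsto_finsetSum _ fun h hh => (hμs I hI h hh).mul
      (tendsto_condProb hσlim (mem_histories_of_mem hJ hh'))
  have hcross : ∀ h' ∈ J, ∀ h'' ∈ J, (∑ h ∈ I, μ I h * G.condProb σ h' h) * μ J h'' =
      (∑ h ∈ I, μ I h * G.condProb σ h'' h) * μ J h' := by
    intro h' hh' h'' hh''
    refine tendsto_nhds_unique ((hw h' hh').mul (hμs J hJ h'' hh'')) ?_
    refine ((hw h'' hh'').mul (hμs J hJ h' hh')).congr fun k => ?_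
    exact (hG.sum_belief_mul_condProb_mul hI hJ hIJ (hbayes k) (fun m _ hm => if_neg hm)
      hh' hh'').symm
  -- The factor is the total weight reaching `J`; summing the cross-multiplied identity over `J`,
  -- where beliefs add up to one, yields it.
  refine ⟨∑ h' ∈ J, ∑ h ∈ I, μ I h * G.condProb σ h' h, Finset.sum_nonneg fun h' hh' =>
    Finset.sum_nonneg fun h hh => mul_nonneg ((hμ I hI).1 h hh)
      (condProb_nonneg hσs (mem_histories_of_mem hJ hh')), fun h' hh' => ?_⟩
  rw [Finset.sum_mul, ← Finset.sum_congr rfl fun h'' hh'' => hcross h' hh' h'' hh'',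
    ← Finset.mul_sum, (hμ J hJ).2, mul_one]

/-- The number of own moves is constant on an information set of the player and increases strictly
after `J`, so only deeper own information sets affect play there. -/
theorem PerfectRecall.expectedUtility_concat_congr (hG : G.PerfectRecall) (i : N)
    {σ σ' : Finset (List Act) → Act → ℝ} {J : Finset (List Act)} (hJ : J ∈ G.infoSets.parts)
    {h : List Act} (hh : h ∈ J) (a : Act)
    (hσ : ∀ m ∈ G.allActions, (G.player m.1 = G.player J → ∀ t ∈ m.1,
      (G.ownMoves (G.player J) h).length < (G.ownMoves (G.player J) t).length) →
        σ m.1 m.2 = σ' m.1 m.2) :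
    G.expectedUtility i σ (h ++ [a]) = G.expectedUtility i σ' (h ++ [a]) := by
  refine expectedUtility_congr i fun t b h1 h2 => hσ (_, b) (concat_mem_allActions h2) ?_
  intro hpl s hs
  change G.player (G.infoSets.part t) = G.player J at hpl
  change s ∈ G.infoSets.part t at hs
  have h3 : h <+: t := (List.prefix_append _ _).trans h1
  have h4 : h ≠ t := by
    rintro rfl
    simpa using h1.length_le
  have h5 := length_ownMoves_lt hJ hh h3 h4
  have h6 := hG.ownMoves_eq (part_mem_of_concat h2) hs (mem_part_of_concat h2)
  rw [hpl] at h6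
  rwa [h6]

/-- The one-shot deviation principle: if no deviation at a single information set is profitable,
then no deviation at a set `T` of information sets of the player is profitable. -/
theorem PerfectRecall.believedUtility_le (hG : G.PerfectRecall)
    {β : Finset (List Act) → Act → ℝ} {μ : Finset (List Act) → List Act → ℝ}
    (hβμ : G.IsAssessment β μ) (hc : G.Consistent β μ) {i : N}
    (hloc : ∀ J ∈ G.infoSets.parts, G.player J = i → ∀ a ∈ G.actions J,
      ∑ h ∈ J, μ J h * G.expectedUtility i β (h ++ [a]) ≤ G.believedUtility i β μ J)
    (T : Finset (Finset (List Act))) (hT : ∀ J ∈ T, J ∈ G.infoSets.parts ∧ G.player J = i)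
    {σ : Finset (List Act) → Act → ℝ} (hσ : G.IsStrategy σ)
    (hσT : ∀ m ∈ G.allActions, m.1 ∉ T → σ m.1 m.2 = β m.1 m.2)
    {I : Finset (List Act)} (hI : I ∈ G.infoSets.parts) (hIi : G.player I = i) :
    G.believedUtility i σ μ I ≤ G.believedUtility i β μ I := by
  classical
  induction T using Finset.strongInduction generalizing σ with
  | H T ih =>
    rcases T.eq_empty_or_nonempty with rfl | hne
    · rw [believedUtility_congr i μ I fun m hm => hσT m hm (by simp)]
    -- Undo the deviation at an information set of `T` with the most own moves: after it, `σ`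
    -- already agrees with `β`, so the single-action condition applies.
    obtain ⟨J, hJT, hmax⟩ := T.exists_max_image
      (fun K => K.sup fun h => (G.ownMoves i h).length) hne
    obtain ⟨hJ, hJi⟩ := hT J hJT
    subst hJi
    have hdepth : ∀ K ∈ T, ∀ t ∈ K, ∀ h ∈ J, (G.ownMoves (G.player J) t).length ≤
        (G.ownMoves (G.player J) h).length := by
      intro K hK t ht h hh
      refine (Finset.le_sup (f := fun h => (G.ownMoves (G.player J) h).length) ht).trans
        ((hmax K hK).trans (Finset.sup_le fun s hs => ?_))
      rw [hG.ownMoves_eq hJ hs hh]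
    let σ' := Function.update σ J (β J)
    have hσ' : G.IsStrategy σ' := by
      intro K hK
      by_cases hKJ : K = J
      · subst hKJ
        simpa [σ'] using hβμ.1 K hK
      · simpa [σ', hKJ] using hσ K hK
    have hσσ' : ∀ m ∈ G.allActions, m.1 ≠ J → σ m.1 m.2 = σ' m.1 m.2 := fun m _ hm => by
      simp [σ', hm]
    have hσ'T : ∀ m ∈ G.allActions, m.1 ∉ T.erase J → σ' m.1 m.2 = β m.1 m.2 := by
      intro m hm hmT
      by_cases hmJ : m.1 = J
      · simp [σ', hmJ]
      · rw [← hσσ' m hm hmJ]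
        exact hσT m hm fun h1 => hmT (Finset.mem_erase.2 ⟨hmJ, h1⟩)
    have h1 := ih (T.erase J) (Finset.erase_ssubset hJT)
      (fun K hK => hT K (Finset.mem_of_mem_erase hK)) hσ' hσ'T
    obtain ⟨l, hl, hlw⟩ := hG.exists_belief_factor hI hJ hIi hβμ.2 hc hσ fun m hm hmJ =>
      hσT m hm fun h1 => hmJ (hT _ h1).2
    have h2 := hG.believedUtility_sub (G.player J) μ hJ hσσ' hlw
    have hbelow : ∀ τ : Finset (List Act) → Act → ℝ,
        (∀ m ∈ G.allActions, m.1 ∉ T → τ m.1 m.2 = β m.1 m.2) → ∀ a,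
        ∑ h ∈ J, μ J h * G.expectedUtility (G.player J) τ (h ++ [a]) =
          ∑ h ∈ J, μ J h * G.expectedUtility (G.player J) β (h ++ [a]) := by
      intro τ hτ a
      refine Finset.sum_congr rfl fun h hh => ?_
      rw [hG.expectedUtility_concat_congr (G.player J) hJ hh a fun m hm hlt =>
        hτ m hm fun hmT => ?_]
      obtain ⟨t, ht⟩ := G.infoSets.nonempty_of_mem_parts (hT _ hmT).1
      exact (hlt (hT _ hmT).2 t ht).not_ge (hdepth _ hmT t ht h hh)
    have h3 : G.believedUtility (G.player J) σ μ J ≤ G.believedUtility (G.player J) β μ J := by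
      rw [believedUtility_eq_sum_actions _ σ μ hJ, ← one_mul (G.believedUtility _ β μ J),
        ← (hσ J hJ).2, Finset.sum_mul]
      refine Finset.sum_le_sum fun a ha => mul_le_mul_of_nonneg_left ?_ ((hσ J hJ).1 a ha)
      rw [hbelow σ hσT]
      exact hloc J hJ rfl a ha
    have h4 : G.believedUtility (G.player J) σ' μ J = G.believedUtility (G.player J) β μ J := by
      rw [believedUtility_eq_sum_actions _ σ' μ hJ, believedUtility_eq_sum_actions _ β μ hJ]
      refine Finset.sum_congr rfl fun a _ => ?_
      rw [hbelow σ' fun m hm hmT => hσ'T m hm fun h1 => hmT (Finset.mem_of_mem_erase h1)]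
      simp [σ']
    -- Restoring `β` at `J` does not lower utility at `J`, hence, scaled by `l ≥ 0`, not at `I`.
    have h5 := mul_nonneg hl (sub_nonneg.2 (h3.trans h4.ge))
    rw [← h2] at h5
    linarith

theorem PerfectRecall.sequentiallyRational_iff (hG : G.PerfectRecall)
    {β : Finset (List Act) → Act → ℝ} {μ : Finset (List Act) → List Act → ℝ}
    (hβμ : G.IsAssessment β μ) (hc : G.Consistent β μ) :
    G.SequentiallyRational β μ ↔ ∀ I ∈ G.infoSets.parts, ∀ a ∈ G.actions I,
      (∑ h ∈ I, μ I h * G.expectedUtility (G.player I) β (h ++ [a])) -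
          G.believedUtility (G.player I) β μ I ≤ 0 ∧
      β I a * ((∑ h ∈ I, μ I h * G.expectedUtility (G.player I) β (h ++ [a])) -
          G.believedUtility (G.player I) β μ I) = 0 := by
  classical
  constructor
  · intro hrat I hI
    have hle : ∀ a ∈ G.actions I,
        (∑ h ∈ I, μ I h * G.expectedUtility (G.player I) β (h ++ [a])) -
          G.believedUtility (G.player I) β μ I ≤ 0 := by
      intro a ha
      -- Deviate to the pure action `a` at `I` only; since `I` is not met again, the continuation
      -- utilities are those of `β`.
      have h1 := hrat I hI (Function.update β I (Pi.single a 1)) ?_ ?_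
      · rw [believedUtility_eq_sum_actions _ _ μ hI, Finset.sum_eq_single_of_mem a ha
          fun b _ hb => by simp [hb]] at h1
        simp only [Function.update_self, Pi.single_eq_same, one_mul] at h1
        rw [sub_nonpos]
        convert h1 using 1
        refine Finset.sum_congr rfl fun h hh => ?_
        rw [hG.expectedUtility_concat_congr (G.player I) hI hh a fun m hm hlt => ?_]
        by_cases hmI : m.1 = I
        · exact absurd (hlt (by rw [hmI]) h (hmI ▸ hh)) (lt_irrefl _)
        · simp [hmI]
      · intro K hK
        by_cases hKI : K = I
        · subst hKI
          simp only [Function.update_self]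
          exact ⟨fun b _ => (Pi.single_nonneg.2 zero_le_one : (0 : Act → ℝ) ≤ _) b,
            by simp [ha]⟩
        · simpa [hKI] using hβμ.1 K hK
      · intro K hK hKI b hb
        rw [Function.update_of_ne]
        rintro rfl
        exact hKI rfl
    intro a ha
    refine ⟨hle a ha, ?_⟩
    -- Believed utility is the `β`-average over actions, so the non-positive products `β D` add up
    -- to zero and each of them vanishes.
    refine (Finset.sum_eq_zero_iff_of_nonpos fun b hb =>
      mul_nonpos_of_nonneg_of_nonpos ((hβμ.1 I hI).1 b hb) (hle b hb)).1 ?_ a ha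
    simp_rw [mul_sub]
    rw [Finset.sum_sub_distrib, ← Finset.sum_mul, (hβμ.1 I hI).2, one_mul, sub_eq_zero]
    exact (believedUtility_eq_sum_actions _ β μ hI).symm
  · intro hloc I hI β' hβ' hoff
    refine hG.believedUtility_le hβμ hc (fun J hJ hJi a ha => ?_)
      (G.infoSets.parts.filter fun J => G.player J = G.player I)
      (fun J hJ => Finset.mem_filter.1 hJ) hβ' (fun m hm hmT => ?_) hI rfl
    · have := (hloc J hJ a ha).1
      rw [hJi] at this
      linarith
    · obtain ⟨h1, h2⟩ := mem_allActions_iff.1 hm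
      exact hoff _ h1 (fun h3 => hmT (Finset.mem_filter.2 ⟨h1, h3⟩)) _ h2

end Deviations

end ExtensiveGame

/-! ### The main theorem -/

theorem mainTheorem1 {N Act : Type*} [DecidableEq N] [Fintype Act] [DecidableEq Act]
    (G : ExtensiveGame N Act) (hG : G.PerfectRecall)
    (pairs : Finset (List Act × List Act)) (hpairs : G.ListsPairs pairs) :
    (∃ ED : Set (↥pairs ⊕ ↥G.allActions → ℝ) → Finset (↥pairs ⊕ ↥G.allActions → ℤ),
      IsExtremeDirectionChoice (G.systemMatrix pairs) ED) ∧
    ∀ ED : Set (↥pairs ⊕ ↥G.allActions → ℝ) → Finset (↥pairs ⊕ ↥G.allActions → ℤ),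
      IsExtremeDirectionChoice (G.systemMatrix pairs) ED →
      (allExtremeDirections (G.systemMatrix pairs) ED).Finite ∧
      ∀ (β : Finset (List Act) → Act → ℝ) (μ : Finset (List Act) → List Act → ℝ),
        G.IsAssessment β μ →
        (G.Consistent β μ ↔
          ∀ p ∈ allExtremeDirections (G.systemMatrix pairs) ED,
            PolynomialEquation (G.alpha pairs β μ) (G.gamma pairs μ) p) ∧
        (G.SequentialEquilibrium β μ ↔
          (∀ I ∈ G.infoSets.parts, ∀ a ∈ G.actions I,
            (∑ h ∈ I, μ I h * G.expectedUtility (G.player I) β (h ++ [a])) -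
                G.believedUtility (G.player I) β μ I ≤ 0 ∧
            β I a * ((∑ h ∈ I, μ I h * G.expectedUtility (G.player I) β (h ++ [a])) -
                G.believedUtility (G.player I) β μ I) = 0) ∧
          ∀ p ∈ allExtremeDirections (G.systemMatrix pairs) ED,
            PolynomialEquation (G.alpha pairs β μ) (G.gamma pairs μ) p) := by
  obtain ⟨A, hA⟩ := G.exists_int_systemMatrix pairs
  refine ⟨hA ▸ exists_isExtremeDirectionChoice A, fun ED hED =>
    ⟨allExtremeDirections_finite _ ED, fun β μ hβμ => ?_⟩⟩
  have hcons : G.Consistent β μ ↔ ∀ p ∈ allExtremeDirections (G.systemMatrix pairs) ED,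
      PolynomialEquation (G.alpha pairs β μ) (G.gamma pairs μ) p :=
    ⟨fun hc p hp => hG.polynomialEquation_of_consistent hpairs hc
      (vecMul_eq_zero_of_mem_allExtremeDirections hED hp),
      hG.consistent_of_polynomialEquation hpairs hED hβμ⟩
  refine ⟨hcons, ?_⟩
  rw [← hcons, ExtensiveGame.SequentialEquilibrium]
  exact and_congr_left fun hc => hG.sequentiallyRational_iff hβμ hc
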